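/- **Setup.** Let $\ell,\wp$ be integers, $\ell\ge 1$, $\wp\ge 0$, and let $X(t)$, $t\ge 0$, be a jointly measurable $\mathbb R^{\wp}$-valued process on a probability space $(\Omega,\mathcal F,P)$ such that the distribution $\mu$ of $X(t)$ does not depend on $t$. Let $\mathcal F_{st}\subset\mathcal F$, $-\infty\le s\le t\le\infty$, be $\sigma$-algebras with $\mathcal F_{st}\subset\mathcal F_{s't'}$ whenever $s'\le s\le t\le t'$. With $\|\cdot\|_r$ the $L^r(\Omega,\mathcal F,P)$-norm, set for $t\ge 0$ and $p,q\ge 1$ $$\varpi_{q,p}(\mathcal G,\mathcal H)=\sup\{\|E[g|\mathcal G]-E[g]\|_p:\ g \text{ real, } \mathcal H\text{-measurable},\ \|g\|_q\le 1\},$$ $$\varpi_{q,p}(t)=\sup_{s\ge 0}\varpi_{q,p}(\mathcal F_{-\infty,s},\mathcal F_{s+t,\infty}),\qquad \beta_q(t)=\sup_{s\ge 0}\|X(s)-E[X(s)|\mathcal F_{s-t,s+t}]\|_q .$$ Let $F:(\mathbb R^{\wp})^{\ell}\to\mathbb R$ satisfy, for some $\iota,K>0$, $\kappa\in(0,1]$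 and all $x=(x_1,\dots,x_\ell)$, $y=(y_1,\dots,y_\ell)$, $$|F(x)-F(y)|\le K\Big(1+\sum_{j=1}^\ell|x_j|^\iota+\sum_{j=1}^\ell|y_j|^\iota\Big)\sum_{j=1}^\ell|x_j-y_j|^\kappa,\qquad |F(x)|\le K\Big(1+\sum_{j=1}^\ell|x_j|^\iota\Big).$$ A sequence $a_n\in[0,\infty]$ is *of size* $-1/2$ if there is a positive, eventually nondecreasing sequence $L_n$ with $\sum_{n\ge1}(nL_n)^{-1}<\infty$, $L_n-L_{n-1}=O(L_n/n)$ and $a_n=O\big((n^{1/2}L_n)^{-1}\big)$ as $n\to\infty$. Assume that there are real numbers $p,q\ge 1$ and $\theta,m>0$ such that $$\theta<\kappa-\frac{(\ell-1)\wp}{p},\qquad \frac12\ge\frac1p+\frac{\iota+2}{m}+\frac{\theta}{q},\qquad \int|x|^m\,d\mu(x)<\infty,\qquad \int|x|^{2q(\iota+2)}\,d\mu(x)<\infty,$$ and such that the sequence $\varpi_{q,p}(n)+\beta_q(n)^\theta$, taken over the integers $n\ge 1$ only, is of size $-1/2$. Let $q_1(t)<q_2(t)<\dots<q_\ell(t)$,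 $t>0$, be positive nondecreasing functions such that for some $\varepsilon\in(0,1]$ and all real $t\ge 1$, $$q_i(t)\ge q_{i-1}(t)+\varepsilon t\quad (i=2,\dots,\ell),\qquad q_i(t+1)\ge q_i(t)+\varepsilon\quad (i=1,\dots,\ell).$$ **Conclusion.** Then $F$ is integrable with respect to $\mu\times\cdots\times\mu$ ($\ell$ factors), and with probability one the function $s\mapsto F(X(q_1(s)),\dots,X(q_\ell(s)))$ is integrable on $(0,t)$ for every $t>0$ and $$\lim_{t\to\infty}\frac1t\int_0^tF\big(X(q_1(s)),\dots,X(q_\ell(s))\big)\,ds=\bar F:=\int F(x_1,\dots,x_\ell)\,d\mu(x_1)\cdots d\mu(x_\ell).$$ -/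

import Mathlib

open MeasureTheory Filter Topology Asymptotics
open scoped ENNReal NNReal

noncomputable section

/-- The dependence coefficient of two sub-σ-algebras: the supremum of
`‖E[g | 𝒢] - E g‖_p` over the real `ℋ`-measurable functions `g` with `‖g‖_q ≤ 1`. -/
def varpi {Ω : Type*} [MeasurableSpace Ω] (P : Measure Ω) (q p : ℝ≥0∞)
    (𝒢 ℋ : MeasurableSpace Ω) : ℝ≥0∞ :=
  ⨆ (g : Ω → ℝ) (_ : Measurable[ℋ] g) (_ : eLpNorm g q P ≤ 1),
    eLpNorm (fun ω => (P[g | 𝒢]) ω - ∫ ω', g ω' ∂P) p P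

/-- The mixing rate `ϖ_{q,p}(t)`: the supremum over `s ≥ 0` of
`ϖ_{q,p}(𝓕_{-∞,s}, 𝓕_{s+t,∞})`. -/
def mixingRate {Ω : Type*} [MeasurableSpace Ω] (P : Measure Ω)
    (𝓕 : EReal → EReal → MeasurableSpace Ω) (q p : ℝ≥0∞) (t : ℝ) : ℝ≥0∞ :=
  ⨆ s : ℝ≥0, varpi P q p (𝓕 ⊥ ((s : ℝ) : EReal)) (𝓕 (((s : ℝ) + t : ℝ) : EReal) ⊤)

/-- The approximation rate `β(q,t)`: the supremum over `s ≥ 0` of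
`‖X(s) - E[X(s) | 𝓕_{s-t,s+t}]‖_q`. -/
def approxRate {Ω : Type*} [MeasurableSpace Ω] (P : Measure Ω)
    (𝓕 : EReal → EReal → MeasurableSpace Ω) {d : ℕ}
    (X : ℝ≥0 → Ω → EuclideanSpace ℝ (Fin d)) (q : ℝ≥0∞) (t : ℝ) : ℝ≥0∞ :=
  ⨆ s : ℝ≥0, eLpNorm
    (fun ω => X s ω -
      (P[X s | 𝓕 (((s : ℝ) - t : ℝ) : EReal) (((s : ℝ) + t : ℝ) : EReal)]) ω) q P

/-- A sequence `a` of extended nonnegative numbers is of size `-1/2` if, for some positive,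
eventually nondecreasing sequence `L` with `∑ 1 / (n L n) < ∞` and
`L n - L (n - 1) = O (L n / n)`, one has `a n = O (1 / (n ^ (1/2) * L n))`.
(The term `n = 0` of the series is `0` by convention.) -/
def IsOfSizeNegHalf (a : ℕ → ℝ≥0∞) : Prop :=
  ∃ L : ℕ → ℝ, (∀ n, 0 < L n) ∧ (∃ N, MonotoneOn L (Set.Ici N)) ∧
    Summable (fun n : ℕ => ((n : ℝ) * L n)⁻¹) ∧
    ((fun n : ℕ => L (n + 1) - L n) =O[atTop] fun n : ℕ => L (n + 1) / ((n : ℝ) + 1)) ∧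
    ∃ C : ℝ, ∀ᶠ n : ℕ in atTop, a n ≤ ENNReal.ofReal (C * (Real.sqrt n * L n)⁻¹)

/-- The mixing, approximation and moment assumption, with mixing and approximation
rates taken at integer times only.  Here `ℓ` is the number of arguments of the observable,
`d` is the dimension of the process, `μ` is its one-dimensional distribution, and `ι`, `κ`
are the growth and Hölder exponents of the observable. -/
def MixingAssumption {Ω : Type*} [MeasurableSpace Ω] (P : Measure Ω)
    (𝓕 : EReal → EReal → MeasurableSpace Ω) {d : ℕ}
    (X : ℝ≥0 → Ω → EuclideanSpace ℝ (Fin d)) (μ : Measure (EuclideanSpace ℝ (Fin d)))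
    (ℓ : ℕ) (ι κ : ℝ) : Prop :=
  ∃ p q θ m : ℝ, 1 ≤ p ∧ 1 ≤ q ∧ 0 < θ ∧ 0 < m ∧
    θ < κ - ((ℓ : ℝ) - 1) * d / p ∧
    1 / p + (ι + 2) / m + θ / q ≤ 1 / 2 ∧
    ∫⁻ x, ‖x‖ₑ ^ m ∂μ < ∞ ∧
    ∫⁻ x, ‖x‖ₑ ^ (2 * q * (ι + 2)) ∂μ < ∞ ∧
    IsOfSizeNegHalf (fun n : ℕ =>
      mixingRate P 𝓕 (ENNReal.ofReal q) (ENNReal.ofReal p) (n : ℝ) +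
        (approxRate P 𝓕 X (ENNReal.ofReal q) (n : ℝ)) ^ θ)

end

/-! ### Almost sure convergence of time averages from decay of correlations -/

/-! For a product f₁(x₁)⋯f_ℓ(x_ℓ) of bounded Lipschitz functions, replacing each factor in turn by
its mean writes the product as the constant `∏ j, c j` plus a sum of terms in which the factor of
highest index i left in the product is centred. In the correlation of such a term at times s ≤ t,
the centred factor at time q_i(t) comes after every other factor by at least ε(t - s - 2), because
the time changes grow and separate linearly. Approximating the other factors by a past σ-algebra and
this one by a future σ-algebra bounds the correlation by a multiple of ϖ + β, hence by a multiple of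
(1 + t - s)^(-1/2) (`exists_correlation_le`). The second moment of the time average over (0, T) is
then O(T^(-1/2)). This is summable along T = k⁴, and boundedness fills the gaps because (k + 1)⁴/k⁴
→ 1 (`ae_tendsto_timeAverage_zero`).

The observable F is only continuous of polynomial growth. By Stone–Weierstrass and a cutoff it lies
within e(1 + ∑‖x_j‖^N) of the algebra generated by bounded Lipschitz functions of one coordinate
(`exists_mem_adjoin_near`), and on this algebra the law follows by linearity. To let e → 0 along
paths, the time averages of ‖X(q_j(s))‖^N must be almost surely bounded (`ae_bddAbove_timeAverage`).
For this the power is truncated at level k + 1 up to time 4^k: the tail is controlled by the moment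
of order N + 2, and the truncated part by the same correlation bound, whose constant does not depend
on the truncation level. -/

theorem ae_tendsto_zero_of_summable_integral {Ω : Type*} [MeasurableSpace Ω] {P : Measure Ω}
    {f : ℕ → Ω → ℝ} {c : ℕ → ℝ} (hf : ∀ k, Integrable (f k) P) (hf0 : ∀ k ω, 0 ≤ f k ω)
    (hfc : ∀ k, ∫ ω, f k ω ∂P ≤ c k) (hc : Summable c) :
    ∀ᵐ ω ∂P, Tendsto (fun k => f k ω) atTop (𝓝 0) := by
  have h1 : ∑' k, ∫⁻ ω, ENNReal.ofReal (f k ω) ∂P ≠ ∞ := by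
    have : ∀ k, ∫⁻ ω, ENNReal.ofReal (f k ω) ∂P ≤ ENNReal.ofReal (c k) := fun k => by
      rw [← ofReal_integral_eq_lintegral_ofReal (hf k) (Eventually.of_forall (hf0 k))]
      exact ENNReal.ofReal_le_ofReal (hfc k)
    refine ne_top_of_le_ne_top ?_ (ENNReal.tsum_le_tsum this)
    exact hc.tsum_ofReal_ne_top
  rw [← lintegral_tsum fun k => (hf k).1.aemeasurable.ennreal_ofReal] at h1
  have h2 := ae_lt_top' (AEMeasurable.tsum
    fun k => (hf k).1.aemeasurable.ennreal_ofReal) h1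
  filter_upwards [h2] with ω hω
  have h3 := ENNReal.tendsto_atTop_zero_of_tsum_ne_top hω.ne
  have h4 := (ENNReal.tendsto_toReal ENNReal.zero_ne_top).comp h3
  simpa [Function.comp_def, ENNReal.toReal_ofReal (hf0 _ ω)] using h4

theorem integral_inv_sqrt_one_add_sub_le {a b : ℝ} (hab : a ≤ b) :
    ∫ x in a..b, (√(1 + (x - a)))⁻¹ ≤ 2 * √(1 + (b - a)) := by
  have hd : ∀ x ∈ Set.uIcc a b, HasDerivAt (fun x => 2 * √(1 + (x - a))) (√(1 + (x - a)))⁻¹ x := by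
    intro x hx
    rw [Set.uIcc_of_le hab] at hx
    have h1 : HasDerivAt (fun x => 1 + (x - a)) 1 x := by
      simpa using ((hasDerivAt_id x).sub_const a).const_add 1
    have h2 := (h1.sqrt (by linarith [hx.1])).const_mul 2
    refine h2.congr_deriv ?_
    rw [one_div, mul_inv, mul_inv_cancel_left₀ two_ne_zero]
  have hc : ContinuousOn (fun x => (√(1 + (x - a)))⁻¹) (Set.uIcc a b) := by
    refine ContinuousOn.inv₀ (by fun_prop) fun x hx => ?_
    rw [Set.uIcc_of_le hab] at hx
    exact (Real.sqrt_pos.2 (by linarith [hx.1])).ne'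
  rw [intervalIntegral.integral_eq_sub_of_hasDerivAt hd hc.intervalIntegrable]
  simp

theorem integral_inv_sqrt_one_add_abs_sub_le {T t : ℝ} (h0 : 0 ≤ t) (hT : t ≤ T) :
    ∫ s in (0 : ℝ)..T, (√(1 + |s - t|))⁻¹ ≤ 4 * √(1 + T) := by
  have hc : Continuous fun s : ℝ => (√(1 + |s - t|))⁻¹ :=
    Continuous.inv₀ (by fun_prop) fun s => (Real.sqrt_pos.2 (by positivity)).ne'
  rw [← intervalIntegral.integral_add_adjacent_intervals (b := t)
    (hc.intervalIntegrable _ _) (hc.intervalIntegrable _ _)]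
  have h1 : ∫ s in (0 : ℝ)..t, (√(1 + |s - t|))⁻¹ ≤ 2 * √(1 + T) := by
    have e : ∫ s in (0 : ℝ)..t, (√(1 + |s - t|))⁻¹
        = ∫ s in (0 : ℝ)..t, (√(1 + (s - 0)))⁻¹ := by
      have := intervalIntegral.integral_comp_sub_left (a := 0) (b := t)
        (fun s : ℝ => (√(1 + (s - 0)))⁻¹) t
      simp only [sub_self, sub_zero] at this ⊢
      rw [← this]
      refine intervalIntegral.integral_congr fun s hs => ?_
      rw [Set.uIcc_of_le h0] at hs
      rw [abs_sub_comm, abs_of_nonneg (by linarith [hs.2])]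
    rw [e]
    refine (integral_inv_sqrt_one_add_sub_le h0).trans ?_
    gcongr; linarith
  have h2 : ∫ s in t..T, (√(1 + |s - t|))⁻¹ ≤ 2 * √(1 + T) := by
    have e : ∫ s in t..T, (√(1 + |s - t|))⁻¹ = ∫ s in t..T, (√(1 + (s - t)))⁻¹ := by
      refine intervalIntegral.integral_congr fun s hs => ?_
      rw [Set.uIcc_of_le hT] at hs
      rw [abs_of_nonneg (by linarith [hs.1])]
    rw [e]
    refine (integral_inv_sqrt_one_add_sub_le hT).trans ?_
    gcongr; linarith
  linarith

theorem integrable_of_abs_le_one {α : Type*} [MeasurableSpace α] {μ : Measure α}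
    [IsFiniteMeasure μ] {f : α → ℝ} (hf : Measurable f) (h : ∀ x, |f x| ≤ 1) : Integrable f μ :=
  Integrable.of_bound hf.aestronglyMeasurable 1 (Eventually.of_forall h)

theorem abs_mul_le_one {a b : ℝ} (ha : |a| ≤ 1) (hb : |b| ≤ 1) : |a * b| ≤ 1 := by
  rw [abs_mul]; exact mul_le_one₀ ha (abs_nonneg _) hb

section

variable {Ω : Type*} [MeasurableSpace Ω] {P : Measure Ω} [IsProbabilityMeasure P]
  {Y : ℝ → Ω → ℝ}

/-- By Fubini the second moment is a double integral of correlations over (0, T]². Integrating (1 +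
|s - t|)^(-1/2) in s costs √(1 + T), and the remaining integral in t costs T. -/
theorem integral_sq_timeIntegral_le (hY : Measurable (Function.uncurry Y))
    (hb : ∀ s ω, |Y s ω| ≤ 1) {C : ℝ}
    (hC : ∀ s t, 0 < s → s ≤ t → |∫ ω, Y s ω * Y t ω ∂P| ≤ C * (√(1 + (t - s)))⁻¹)
    {T : ℝ} (hT : 0 ≤ T) :
    ∫ ω, (∫ s in (0 : ℝ)..T, Y s ω) ^ 2 ∂P ≤ 4 * C * T * √(1 + T) := by
  have hC0 : 0 ≤ C := by
    have := (abs_nonneg _).trans (hC 1 1 one_pos le_rfl)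
    simpa using this
  set ν : Measure ℝ := volume.restrict (Set.Ioc 0 T) with hν
  have hYY : Measurable (Function.uncurry fun (ω : Ω) (z : ℝ × ℝ) => Y z.1 ω * Y z.2 ω) := by
    have h1 : Measurable fun x : Ω × ℝ × ℝ => Y x.2.1 x.1 :=
      hY.comp (measurable_snd.fst.prodMk measurable_fst)
    have h2 : Measurable fun x : Ω × ℝ × ℝ => Y x.2.2 x.1 :=
      hY.comp (measurable_snd.snd.prodMk measurable_fst)
    exact h1.mul h2
  have hint : Integrable (Function.uncurry fun (ω : Ω) (z : ℝ × ℝ) => Y z.1 ω * Y z.2 ω)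
      (P.prod (ν.prod ν)) :=
    integrable_of_abs_le_one hYY fun x => abs_mul_le_one (hb _ _) (hb _ _)
  have e1 : ∫ ω, (∫ s in (0 : ℝ)..T, Y s ω) ^ 2 ∂P
      = ∫ z, ∫ ω, Y z.1 ω * Y z.2 ω ∂P ∂(ν.prod ν) := by
    rw [← integral_integral_swap hint]
    refine integral_congr_ae (Eventually.of_forall fun ω => ?_)
    simp only
    rw [integral_prod_mul (fun s => Y s ω) fun s => Y s ω, intervalIntegral.integral_of_le hT,
      sq]
  have hcont : Continuous fun z : ℝ × ℝ => C * (√(1 + |z.2 - z.1|))⁻¹ :=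
    Continuous.mul continuous_const <|
      Continuous.inv₀ (by fun_prop) fun s => (Real.sqrt_pos.2 (by positivity)).ne'
  have hint2 : Integrable (fun z : ℝ × ℝ => C * (√(1 + |z.2 - z.1|))⁻¹) (ν.prod ν) := by
    refine Integrable.of_bound hcont.aestronglyMeasurable C (Eventually.of_forall fun z => ?_)
    rw [Real.norm_eq_abs, abs_of_nonneg (by positivity)]
    refine mul_le_of_le_one_right hC0 (inv_le_one_of_one_le₀ ?_)
    exact Real.one_le_sqrt.2 (by linarith [abs_nonneg (z.2 - z.1)])
  have hae : ∀ᵐ z ∂(ν.prod ν), z ∈ Set.Ioc 0 T ×ˢ Set.Ioc 0 T := by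
    rw [hν, Measure.prod_restrict]
    exact ae_restrict_mem (measurableSet_Ioc.prod measurableSet_Ioc)
  rw [e1]
  calc ∫ z, ∫ ω, Y z.1 ω * Y z.2 ω ∂P ∂(ν.prod ν)
      ≤ ∫ z : ℝ × ℝ, C * (√(1 + |z.2 - z.1|))⁻¹ ∂(ν.prod ν) := by
        refine integral_mono_ae hint.integral_prod_right hint2 ?_
        filter_upwards [hae] with z hz
        rcases le_total z.1 z.2 with h | h
        · rw [abs_of_nonneg (by linarith)]
          exact (le_abs_self _).trans (hC _ _ hz.1.1 h)
        · rw [abs_sub_comm, abs_of_nonneg (by linarith)]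
          refine (le_abs_self _).trans ?_
          simp_rw [mul_comm (Y z.1 _)]
          exact hC _ _ hz.2.1 h
    _ = ∫ t, ∫ s, C * (√(1 + |s - t|))⁻¹ ∂ν ∂ν := integral_prod _ hint2
    _ ≤ ∫ _, C * (4 * √(1 + T)) ∂ν := by
        refine integral_mono_ae hint2.integral_prod_left (integrable_const _) ?_
        filter_upwards [ae_restrict_mem measurableSet_Ioc] with t ht
        rw [integral_const_mul, hν, ← intervalIntegral.integral_of_le hT]
        exact mul_le_mul_of_nonneg_left (integral_inv_sqrt_one_add_abs_sub_le ht.1.le ht.2) hC0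
    _ = 4 * C * T * √(1 + T) := by
        simp [hν, hT, measureReal_def]; ring

theorem measurable_timeIntegral (hY : Measurable (Function.uncurry Y)) (T : ℝ) :
    StronglyMeasurable fun ω => ∫ s in (0 : ℝ)..T, Y s ω := by
  have h : StronglyMeasurable (Function.uncurry fun ω s => Y s ω) :=
    (hY.comp measurable_swap).stronglyMeasurable
  simp only [intervalIntegral]
  exact (h.integral_prod_right (ν := volume.restrict (Set.Ioc 0 T))).sub
    (h.integral_prod_right (ν := volume.restrict (Set.Ioc T 0)))

theorem abs_timeIntegral_le {y : ℝ → ℝ} (hb : ∀ s, |y s| ≤ 1) {a b : ℝ} (hab : a ≤ b) :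
    |∫ s in a..b, y s| ≤ b - a := by
  have := intervalIntegral.norm_integral_le_of_norm_le_const (a := a) (b := b) (C := 1)
    (f := y) fun s _ => hb s
  rwa [one_mul, abs_of_nonneg (by linarith : 0 ≤ b - a)] at this

theorem integrable_sq_timeAverage (hY : Measurable (Function.uncurry Y))
    (hb : ∀ s ω, |Y s ω| ≤ 1) {T : ℝ} (hT : 0 ≤ T) :
    Integrable (fun ω => (1 / T * ∫ s in (0 : ℝ)..T, Y s ω) ^ 2) P := by
  refine integrable_of_abs_le_one
    (((measurable_timeIntegral hY T).measurable.const_mul _).pow_const 2) fun ω => ?_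
  rw [abs_pow]
  refine pow_le_one₀ (abs_nonneg _) ?_
  have := abs_timeIntegral_le (hb · ω) hT
  rw [abs_mul, abs_of_nonneg (by positivity)]
  rcases hT.eq_or_lt with rfl | h
  · simp
  · rw [one_div, inv_mul_le_iff₀ h]; linarith

theorem integral_sq_timeAverage_le (hY : Measurable (Function.uncurry Y))
    (hb : ∀ s ω, |Y s ω| ≤ 1) {C : ℝ}
    (hC : ∀ s t, 0 < s → s ≤ t → |∫ ω, Y s ω * Y t ω ∂P| ≤ C * (√(1 + (t - s)))⁻¹)
    {T : ℝ} (hT : 1 ≤ T) :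
    ∫ ω, (1 / T * ∫ s in (0 : ℝ)..T, Y s ω) ^ 2 ∂P ≤ 8 * C * (√T)⁻¹ := by
  have hC0 : 0 ≤ C := by
    have := (abs_nonneg _).trans (hC 1 1 one_pos le_rfl)
    simpa using this
  simp_rw [mul_pow]
  rw [integral_const_mul]
  have h1 := integral_sq_timeIntegral_le (P := P) hY hb hC (zero_le_one.trans hT)
  have h2 : √(1 + T) ≤ 2 * √T := by
    rw [show (2 : ℝ) * √T = √(4 * T) by
      rw [Real.sqrt_mul (by norm_num), show (4 : ℝ) = 2 ^ 2 by norm_num,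
        Real.sqrt_sq (by norm_num)]]
    exact Real.sqrt_le_sqrt (by linarith)
  have hT0 : 0 < T := by linarith
  have hs : 0 < √T := Real.sqrt_pos.2 hT0
  have hss : √T * √T = T := Real.mul_self_sqrt hT0.le
  calc (1 / T) ^ 2 * ∫ ω, (∫ s in (0 : ℝ)..T, Y s ω) ^ 2 ∂P
      ≤ (1 / T) ^ 2 * (4 * C * T * (2 * √T)) := by gcongr; exact h1.trans (by gcongr)
    _ = 8 * C * (√T)⁻¹ := by
        obtain ⟨r, hr⟩ : ∃ r, r = √T := ⟨_, rfl⟩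
        rw [← hr] at hs hss ⊢
        rw [← hss]; field_simp; ring

/-- Bounded processes whose correlations decay like `|t - s| ^ (-1/2)` satisfy the strong law of
large numbers. -/
theorem ae_tendsto_timeAverage_zero (hY : Measurable (Function.uncurry Y))
    (hb : ∀ s ω, |Y s ω| ≤ 1) {C : ℝ}
    (hC : ∀ s t, 0 < s → s ≤ t → |∫ ω, Y s ω * Y t ω ∂P| ≤ C * (√(1 + (t - s)))⁻¹) :
    ∀ᵐ ω ∂P, Tendsto (fun T : ℝ => (1 / T) * ∫ s in (0 : ℝ)..T, Y s ω) atTop (𝓝 0) := by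
  have hsum : Summable fun k : ℕ => 8 * C * (((k : ℝ) + 1) ^ 2)⁻¹ := by
    refine Summable.mul_left _ ?_
    have := (summable_nat_add_iff 1).2 (Real.summable_nat_pow_inv.2 (one_lt_two))
    simpa using this
  -- At T = (k + 1)⁴ the bound T^(-1/2) becomes (k + 1)^(-2), which is summable.
  have hae := ae_tendsto_zero_of_summable_integral (P := P)
    (f := fun k ω => (1 / ((k : ℝ) + 1) ^ 4 * ∫ s in (0 : ℝ)..((k : ℝ) + 1) ^ 4, Y s ω) ^ 2)
    (fun k => integrable_sq_timeAverage hY hb (by positivity)) (fun k ω => sq_nonneg _)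
    (fun k => by
      refine (integral_sq_timeAverage_le hY hb hC
        (one_le_pow₀ (by linarith [k.cast_nonneg (α := ℝ)]))).trans_eq ?_
      rw [show ((k : ℝ) + 1) ^ 4 = (((k : ℝ) + 1) ^ 2) ^ 2 by ring,
        Real.sqrt_sq (by positivity)]) hsum
  filter_upwards [hae] with ω hω
  have hmeas : Measurable fun s => Y s ω := hY.comp measurable_prodMk_right
  have hii : ∀ a b : ℝ, IntervalIntegrable (fun s => Y s ω) volume a b := fun a b =>
    (intervalIntegrable_const (c := (1 : ℝ))).mono_fun hmeas.aestronglyMeasurable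
      (Eventually.of_forall fun s => by simpa using hb s ω)
  have hroot : Tendsto (fun k : ℕ => |1 / ((k : ℝ) + 1) ^ 4 *
      ∫ s in (0 : ℝ)..((k : ℝ) + 1) ^ 4, Y s ω|) atTop (𝓝 0) := by
    have := (Real.continuous_sqrt.tendsto 0).comp hω
    simpa [Function.comp_def, Real.sqrt_sq_eq_abs] using this
  -- The relative length ((k + 2)⁴ - (k + 1)⁴)/(k + 1)⁴ of the gap between consecutive sampling
  -- times.
  have hfrac : Tendsto (fun k : ℕ => (1 + 1 / ((k : ℝ) + 1)) ^ 4 - 1) atTop (𝓝 0) := by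
    have := ((tendsto_one_div_add_atTop_nhds_zero_nat (𝕜 := ℝ)).const_add 1).pow 4 |>.sub_const 1
    simpa using this
  -- With k = ⌊T^(1/4)⌋ - 1 one has (k + 1)⁴ ≤ T ≤ (k + 2)⁴. The truncated subtraction is harmless
  -- once T ≥ 1.
  have hk : Tendsto (fun T : ℝ => ⌊√(√T)⌋₊ - 1) atTop atTop :=
    (tendsto_sub_atTop_nat 1).comp <| tendsto_nat_floor_atTop.comp <|
      Real.tendsto_sqrt_atTop.comp Real.tendsto_sqrt_atTop
  have hlim := (hroot.add hfrac).comp hk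
  rw [add_zero] at hlim
  refine squeeze_zero_norm' ?_ hlim
  filter_upwards [eventually_ge_atTop 1] with T hT
  have hT0 : (0 : ℝ) ≤ T := by linarith
  have hfl : 1 ≤ ⌊√(√T)⌋₊ := Nat.le_floor (by
    simpa using Real.one_le_sqrt.2 (Real.one_le_sqrt.2 hT))
  obtain ⟨k, hk⟩ := Nat.exists_eq_add_of_le' hfl
  have h4 : (√(√T)) ^ 4 = T := by
    rw [show (4 : ℕ) = 2 * 2 by norm_num, pow_mul, Real.sq_sqrt (Real.sqrt_nonneg _),
      Real.sq_sqrt hT0]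
  have hlow : ((k : ℝ) + 1) ^ 4 ≤ T := by
    rw [← h4]; gcongr
    have := Nat.floor_le (Real.sqrt_nonneg (√T)); rw [hk] at this; exact_mod_cast this
  have hup : T ≤ ((k : ℝ) + 2) ^ 4 := by
    rw [← h4]; gcongr
    have := (Nat.lt_floor_add_one (√(√T))).le; rw [hk] at this; push_cast at this; linarith
  simp only [Function.comp_def, hk, Nat.add_sub_cancel]
  set S := ((k : ℝ) + 1) ^ 4 with hS
  have hS0 : 0 < S := by positivity
  rw [← intervalIntegral.integral_add_adjacent_intervals (hii 0 S) (hii S T), Real.norm_eq_abs,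
    mul_add]
  refine (abs_add_le _ _).trans (add_le_add ?_ ?_)
  · rw [abs_mul, abs_mul, abs_of_nonneg (by positivity : 0 ≤ 1 / T),
      abs_of_nonneg (by positivity : 0 ≤ 1 / S)]
    gcongr
  · rw [abs_mul, abs_of_nonneg (by positivity : 0 ≤ 1 / T)]
    calc 1 / T * |∫ s in S..T, Y s ω| ≤ 1 / S * (((k : ℝ) + 2) ^ 4 - S) := by
          gcongr
          exact (abs_timeIntegral_le (hb · ω) hlow).trans (by linarith)
      _ = (1 + 1 / ((k : ℝ) + 1)) ^ 4 - 1 := by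
          rw [hS]; field_simp; ring

end

/-! ### Covariance estimates -/

/-- `A` is a random variable with values in `[-1, 1]` which is at `L¹`-distance at most `δ` from
an `m`-measurable random variable with values in `[-1, 1]`. -/
structure IsNearMeasurable {Ω : Type*} (m : MeasurableSpace Ω) [mΩ : MeasurableSpace Ω]
    (P : Measure Ω) (A : Ω → ℝ) (δ : ℝ≥0∞) : Prop where
  measurable : Measurable A
  abs_le_one : ∀ ω, |A ω| ≤ 1
  exists_near : ∃ A' : Ω → ℝ, Measurable[m] A' ∧ (∀ ω, |A' ω| ≤ 1) ∧
    ∫⁻ ω, ‖A ω - A' ω‖ₑ ∂P ≤ δ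

section

variable {Ω : Type*} {m m' : MeasurableSpace Ω} [mΩ : MeasurableSpace Ω] {P : Measure Ω}

theorem enorm_le_one_of_abs_le_one {a : ℝ} (h : |a| ≤ 1) : ‖a‖ₑ ≤ 1 := by
  rw [Real.enorm_eq_ofReal_abs]; exact ENNReal.ofReal_le_one.2 h

namespace IsNearMeasurable

theorem one : IsNearMeasurable m P (fun _ => 1) 0 :=
  ⟨measurable_const, by simp, fun _ => 1, measurable_const, by simp, by simp⟩

theorem mono {A : Ω → ℝ} {δ : ℝ≥0∞} (h : IsNearMeasurable m P A δ)
    (hm : m ≤ m') : IsNearMeasurable m' P A δ :=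
  let ⟨A', h1, h2, h3⟩ := h.exists_near
  ⟨h.measurable, h.abs_le_one, A', h1.mono hm le_rfl, h2, h3⟩

theorem mul (hm : m ≤ mΩ) {A B : Ω → ℝ} {δ η : ℝ≥0∞}
    (hA : IsNearMeasurable m P A δ) (hB : IsNearMeasurable m P B η) :
    IsNearMeasurable m P (fun ω => A ω * B ω) (δ + η) := by
  obtain ⟨A', hA1, hA2, hA3⟩ := hA.exists_near
  obtain ⟨B', hB1, hB2, hB3⟩ := hB.exists_near
  refine ⟨hA.measurable.mul hB.measurable,
    fun ω => abs_mul_le_one (hA.abs_le_one ω) (hB.abs_le_one ω), fun ω => A' ω * B' ω,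
    hA1.mul hB1, fun ω => abs_mul_le_one (hA2 ω) (hB2 ω), ?_⟩
  have hmeas : Measurable fun ω => ‖A ω - A' ω‖ₑ :=
    (hA.measurable.sub (hA1.mono hm le_rfl)).enorm
  calc ∫⁻ ω, ‖A ω * B ω - A' ω * B' ω‖ₑ ∂P
      ≤ ∫⁻ ω, (‖A ω - A' ω‖ₑ + ‖B ω - B' ω‖ₑ) ∂P := by
        refine lintegral_mono fun ω => ?_
        have e : A ω * B ω - A' ω * B' ω = (A ω - A' ω) * B ω + A' ω * (B ω - B' ω) := by ring
        rw [e]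
        refine (enorm_add_le _ _).trans (add_le_add ?_ ?_)
        · rw [enorm_mul]
          exact mul_le_of_le_one_right' (enorm_le_one_of_abs_le_one (hB.abs_le_one ω))
        · rw [enorm_mul]
          exact mul_le_of_le_one_left' (enorm_le_one_of_abs_le_one (hA2 ω))
    _ = ∫⁻ ω, ‖A ω - A' ω‖ₑ ∂P + ∫⁻ ω, ‖B ω - B' ω‖ₑ ∂P := lintegral_add_left hmeas _
    _ ≤ δ + η := add_le_add hA3 hB3

theorem prod {ι : Type*} (hm : m ≤ mΩ) {A : ι → Ω → ℝ} {δ : ℝ≥0∞}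
    (s : Finset ι) (hA : ∀ i ∈ s, IsNearMeasurable m P (A i) δ) :
    IsNearMeasurable m P (fun ω => ∏ i ∈ s, A i ω) (s.card * δ) := by
  classical
  induction s using Finset.induction_on with
  | empty => simpa using one
  | insert i s hi ih =>
    have := (hA i (Finset.mem_insert_self _ _)).mul hm
      (ih fun j hj => hA j (Finset.mem_insert_of_mem hj))
    simp only [Finset.prod_insert hi, Finset.card_insert_of_notMem hi]
    convert this using 1
    push_cast; ring

variable [IsProbabilityMeasure P]

/-- The approximant is f applied to the conditional expectation of Z. Only the measurability of `P[Z
| m]` matters, so its default value 0 for nonintegrable Z is allowed. -/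
theorem comp_of_lipschitz {E : Type*} [NormedAddCommGroup E] [InnerProductSpace ℝ E]
    [CompleteSpace E] [MeasurableSpace E] [BorelSpace E] [SecondCountableTopology E]
    (hm : m ≤ mΩ) {Z : Ω → E} (hZ : Measurable Z)
    {f : E → ℝ} {Λ : ℝ≥0} (hf : LipschitzWith Λ f) (hf1 : ∀ x, |f x| ≤ 1)
    {q : ℝ≥0∞} (hq : 1 ≤ q) :
    IsNearMeasurable m P (fun ω => f (Z ω)) (Λ * eLpNorm (fun ω => Z ω - (P[Z | m]) ω) q P) := by
  have hZ' : Measurable[m] (P[Z | m]) := stronglyMeasurable_condExp.measurable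
  refine ⟨hf.continuous.measurable.comp hZ, fun ω => hf1 _, fun ω => f ((P[Z | m]) ω),
    hf.continuous.measurable.comp hZ', fun ω => hf1 _, ?_⟩
  calc ∫⁻ ω, ‖f (Z ω) - f ((P[Z | m]) ω)‖ₑ ∂P
      ≤ ∫⁻ ω, Λ * ‖Z ω - (P[Z | m]) ω‖ₑ ∂P := by
        refine lintegral_mono fun ω => ?_
        rw [← edist_eq_enorm_sub, ← edist_eq_enorm_sub]
        exact hf _ _
    _ = Λ * eLpNorm (fun ω => Z ω - (P[Z | m]) ω) 1 P := by
        rw [lintegral_const_mul' _ _ ENNReal.coe_ne_top, eLpNorm_one_eq_lintegral_enorm]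
    _ ≤ _ := by
        gcongr
        exact eLpNorm_le_eLpNorm_of_exponent_le hq
          (hZ.sub (hZ'.mono hm le_rfl)).aestronglyMeasurable

/-- Passing from A to A' costs δ and from G to G' costs η. In E[A'G'] the factor A' is
`m`-measurable, so G' may be replaced by its conditional expectation, which is within `varpi` of
E[G'] in Lᵖ, hence in L¹. As E[G] = 0, the mean of G' is at most η, which is the second η. -/
theorem enorm_integral_mul_le (hm : m ≤ mΩ) (hm' : m' ≤ mΩ)
    {A G : Ω → ℝ} {δ η : ℝ≥0∞} (hA : IsNearMeasurable m P A δ) (hG : IsNearMeasurable m' P G η)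
    (hG0 : ∫ ω, G ω ∂P = 0) {q p : ℝ≥0∞} (hp : 1 ≤ p) :
    ‖∫ ω, A ω * G ω ∂P‖ₑ ≤ δ + 2 * η + varpi P q p m m' := by
  obtain ⟨A', hA1, hA2, hA3⟩ := hA.exists_near
  obtain ⟨G', hG1, hG2, hG3⟩ := hG.exists_near
  have hA1' := hA1.mono hm le_rfl
  have hG1' := hG1.mono hm' le_rfl
  have hGi := integrable_of_abs_le_one (μ := P) hG.measurable hG.abs_le_one
  have hGi' := integrable_of_abs_le_one (μ := P) hG1' hG2
  have i1 : Integrable (fun ω => (A ω - A' ω) * G ω) P := by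
    have a := integrable_of_abs_le_one (μ := P) (hA.measurable.mul hG.measurable)
      fun ω => abs_mul_le_one (hA.abs_le_one ω) (hG.abs_le_one ω)
    have b := integrable_of_abs_le_one (μ := P) (hA1'.mul hG.measurable)
      fun ω => abs_mul_le_one (hA2 ω) (hG.abs_le_one ω)
    exact (a.sub b).congr (Eventually.of_forall fun ω => by simp; ring)
  have i3 : Integrable (fun ω => A' ω * G' ω) P :=
    integrable_of_abs_le_one (hA1'.mul hG1') fun ω => abs_mul_le_one (hA2 ω) (hG2 ω)
  have i2 : Integrable (fun ω => A' ω * (G ω - G' ω)) P := by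
    have b := integrable_of_abs_le_one (μ := P) (hA1'.mul hG.measurable)
      fun ω => abs_mul_le_one (hA2 ω) (hG.abs_le_one ω)
    exact (b.sub i3).congr (Eventually.of_forall fun ω => by simp; ring)
  set c := ∫ ω, G' ω ∂P with hc
  have hcη : ‖c‖ₑ ≤ η := by
    have e : -c = ∫ ω, (G ω - G' ω) ∂P := by rw [integral_sub hGi hGi', hG0, hc]; ring
    rw [← enorm_neg, e]
    exact (enorm_integral_le_lintegral_enorm _).trans hG3
  have e0 : ∫ ω, A ω * G ω ∂P = ∫ ω, (A ω - A' ω) * G ω ∂P + ∫ ω, A' ω * (G ω - G' ω) ∂P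
      + ∫ ω, A' ω * G' ω ∂P := by
    rw [← integral_add i1 i2, ← integral_add (by exact i1.add i2) i3]
    exact integral_congr_ae (Eventually.of_forall fun ω => by ring)
  have h1 : ‖∫ ω, (A ω - A' ω) * G ω ∂P‖ₑ ≤ δ := by
    refine (enorm_integral_le_lintegral_enorm _).trans ((lintegral_mono fun ω => ?_).trans hA3)
    rw [enorm_mul]
    exact mul_le_of_le_one_right' (enorm_le_one_of_abs_le_one (hG.abs_le_one ω))
  have h2 : ‖∫ ω, A' ω * (G ω - G' ω) ∂P‖ₑ ≤ η := by
    refine (enorm_integral_le_lintegral_enorm _).trans ((lintegral_mono fun ω => ?_).trans hG3)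
    rw [enorm_mul]
    exact mul_le_of_le_one_left' (enorm_le_one_of_abs_le_one (hA2 ω))
  have h3 : ‖∫ ω, A' ω * G' ω ∂P‖ₑ ≤ varpi P q p m m' + η := by
    have e1 : ∫ ω, A' ω * G' ω ∂P = ∫ ω, A' ω * (P[G' | m]) ω ∂P := by
      rw [← integral_condExp hm]
      exact integral_congr_ae (condExp_stronglyMeasurable_mul_of_bound hm
        hA1.stronglyMeasurable hGi' 1 (Eventually.of_forall hA2))
    have hq1 : eLpNorm G' q P ≤ 1 := by
      refine (eLpNorm_le_of_ae_bound (C := 1) (Eventually.of_forall hG2)).trans ?_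
      simp
    calc ‖∫ ω, A' ω * G' ω ∂P‖ₑ ≤ ∫⁻ ω, ‖A' ω * (P[G' | m]) ω‖ₑ ∂P := by
          rw [e1]; exact enorm_integral_le_lintegral_enorm _
      _ ≤ ∫⁻ ω, (‖(P[G' | m]) ω - c‖ₑ + η) ∂P := by
          refine lintegral_mono fun ω => ?_
          rw [enorm_mul]
          refine (mul_le_of_le_one_left' (enorm_le_one_of_abs_le_one (hA2 ω))).trans ?_
          calc ‖(P[G' | m]) ω‖ₑ = ‖((P[G' | m]) ω - c) + c‖ₑ := by rw [sub_add_cancel]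
            _ ≤ _ := (enorm_add_le _ _).trans (by gcongr)
      _ = eLpNorm (fun ω => (P[G' | m]) ω - c) 1 P + η := by
          rw [lintegral_add_right _ measurable_const, eLpNorm_one_eq_lintegral_enorm]; simp
      _ ≤ _ := by
          gcongr
          refine (eLpNorm_le_eLpNorm_of_exponent_le hp
            (integrable_condExp.sub (integrable_const c)).1).trans ?_
          exact le_iSup₂_of_le G' hG1 (le_iSup_of_le hq1 le_rfl)
  rw [e0]
  calc _ ≤ δ + η + (varpi P q p m m' + η) :=
        (enorm_add_le _ _).trans (add_le_add ((enorm_add_le _ _).trans (add_le_add h1 h2)) h3)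
    _ = _ := by ring

end IsNearMeasurable

/-! ### From the size condition to a rate of order n^(-1/2) -/

theorem IsOfSizeNegHalf.exists_le {a : ℕ → ℝ≥0∞} (ha : IsOfSizeNegHalf a) :
    ∃ C : ℝ, 0 ≤ C ∧ ∀ᶠ n : ℕ in atTop, a n ≤ ENNReal.ofReal (C * (√((n : ℝ) + 1))⁻¹) := by
  obtain ⟨L, hL0, ⟨N, hN⟩, -, -, C, hC⟩ := ha
  -- Eventual monotonicity keeps L n ≥ L N > 0. The factor 2 comes from √(n + 1) ≤ 2√n.
  refine ⟨2 * |C| * (L N)⁻¹, by have := hL0 N; positivity, ?_⟩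
  filter_upwards [hC, eventually_ge_atTop N, eventually_ge_atTop 1] with n hn hNn hn1
  refine hn.trans (ENNReal.ofReal_le_ofReal ?_)
  have h1 : L N ≤ L n := hN (Set.mem_Ici.2 le_rfl) hNn hNn
  have hn1' : (1 : ℝ) ≤ n := by exact_mod_cast hn1
  have h2 : √((n : ℝ) + 1) ≤ 2 * √n := by
    rw [show (2 : ℝ) * √n = √(4 * n) by
      rw [Real.sqrt_mul (by norm_num), show (4 : ℝ) = 2 ^ 2 by norm_num,
        Real.sqrt_sq (by norm_num)]]
    exact Real.sqrt_le_sqrt (by linarith)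
  have hs : 0 < √((n : ℝ) + 1) := Real.sqrt_pos.2 (by linarith)
  have hLN := hL0 N
  calc C * (√n * L n)⁻¹ ≤ |C| * (√((n : ℝ) + 1) / 2 * L N)⁻¹ := by
        have h3 : √((n : ℝ) + 1) / 2 ≤ √n := by linarith
        have h4 : 0 ≤ (√n * L n)⁻¹ := by have := hL0 n; positivity
        refine (mul_le_mul_of_nonneg_right (le_abs_self C) h4).trans ?_
        gcongr
    _ = _ := by rw [mul_inv, inv_div]; ring

/-- Since θ ≤ 1, a number in [0, 1] is at most its θ-th power, so a bound on b^θ passes to b. The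
minimum with 1 covers values where this fails. -/
theorem exists_min_one_rates_le {a b : ℕ → ℝ≥0∞} {θ : ℝ} (hθ : 0 < θ) (hθ1 : θ ≤ 1)
    (h : IsOfSizeNegHalf fun n => a n + b n ^ θ) :
    ∃ C : ℝ, 0 ≤ C ∧ ∀ n, min 1 (a n + b n) ≤ ENNReal.ofReal (C * (√((n : ℝ) + 1))⁻¹) := by
  obtain ⟨C, hC, hn⟩ := h.exists_le
  obtain ⟨N, hN⟩ := eventually_atTop.1 hn
  -- The summand √(N + 1) makes the bound at least 1 for all n ≤ N.
  refine ⟨2 * C + √((N : ℝ) + 1), by positivity, fun n => ?_⟩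
  have hs : 0 < √((n : ℝ) + 1) := Real.sqrt_pos.2 (by positivity)
  rcases le_total N n with h | h
  · set y : ℝ := C * (√((n : ℝ) + 1))⁻¹ with hy
    have hy0 : 0 ≤ y := by positivity
    have h1 : a n ≤ ENNReal.ofReal y := le_self_add.trans (hN n h)
    have h2 : b n ^ θ ≤ ENNReal.ofReal y := le_add_self.trans (hN n h)
    have h3 : min 1 (b n) ≤ ENNReal.ofReal y := by
      rcases le_total 1 y with hy1 | hy1
      · exact (min_le_left _ _).trans (by simpa using hy1)
      · refine (min_le_right _ _).trans ?_
        rw [← ENNReal.rpow_le_rpow_iff hθ]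
        refine h2.trans ?_
        calc ENNReal.ofReal y = ENNReal.ofReal y ^ (1 : ℝ) := by simp
          _ ≤ _ := ENNReal.rpow_le_rpow_of_exponent_ge (by simpa using hy1) hθ1
    calc min 1 (a n + b n) ≤ a n + min 1 (b n) := by
          rcases le_total 1 (b n) with hb | hb
          · rw [min_eq_left hb]; exact (min_le_left _ _).trans le_add_self
          · rw [min_eq_right hb]; exact min_le_right _ _
      _ ≤ ENNReal.ofReal y + ENNReal.ofReal y := add_le_add h1 h3
      _ = ENNReal.ofReal (2 * y) := by rw [← ENNReal.ofReal_add hy0 hy0, two_mul]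
      _ ≤ _ := by
          refine ENNReal.ofReal_le_ofReal ?_
          rw [hy, ← mul_assoc]; gcongr; linarith [Real.sqrt_nonneg ((N : ℝ) + 1)]
  · refine (min_le_left _ _).trans ?_
    rw [ENNReal.one_le_ofReal, ← div_eq_mul_inv, one_le_div hs]
    have : √((n : ℝ) + 1) ≤ √((N : ℝ) + 1) := by gcongr
    linarith

/-- Consequence of the mixing and approximation assumption used below. -/
def HasMixingRate (P : Measure Ω) (𝓕 : EReal → EReal → MeasurableSpace Ω) {d : ℕ}
    (X : ℝ≥0 → Ω → EuclideanSpace ℝ (Fin d)) : Prop :=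
  ∃ p q : ℝ≥0∞, 1 ≤ p ∧ 1 ≤ q ∧ ∃ C : ℝ, 0 ≤ C ∧
    ∀ n : ℕ, min 1 (mixingRate P 𝓕 q p n + approxRate P 𝓕 X q n) ≤
      ENNReal.ofReal (C * (√((n : ℝ) + 1))⁻¹)

theorem MixingAssumption.hasMixingRate {𝓕 : EReal → EReal → MeasurableSpace Ω} {d : ℕ}
    {X : ℝ≥0 → Ω → EuclideanSpace ℝ (Fin d)} {μ : Measure (EuclideanSpace ℝ (Fin d))}
    {ℓ : ℕ} (hℓ : 1 ≤ ℓ) {ι κ : ℝ} (hκ : κ ≤ 1) (h : MixingAssumption P 𝓕 X μ ℓ ι κ) :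
    HasMixingRate P 𝓕 X := by
  obtain ⟨p, q, θ, m, hp, hq, hθ, -, hθκ, -, -, -, hs⟩ := h
  have h0 : 0 ≤ ((ℓ : ℝ) - 1) * d / p := by
    have : (1 : ℝ) ≤ ℓ := by exact_mod_cast hℓ
    have : 0 ≤ (ℓ : ℝ) - 1 := by linarith
    positivity
  -- θ < κ - (ℓ - 1)d/p ≤ κ ≤ 1.
  exact ⟨ENNReal.ofReal p, ENNReal.ofReal q, by simpa using hp, by simpa using hq,
    exists_min_one_rates_le hθ (by linarith) hs⟩

end

/-! ### Decay of correlations along the time changes -/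

/-- Monotone time changes which grow at a linear rate and separate from each other at a linear
rate. -/
structure IsSeparating {ℓ : ℕ} (Q : Fin ℓ → ℝ → ℝ≥0) (ε : ℝ) : Prop where
  mono : ∀ i, Monotone (Q i)
  le_of_lt : ∀ i j, j < i → ∀ t, 0 < t → Q j t ≤ Q i t
  growth : ∀ i s t, 0 < s → s ≤ t → (Q i s : ℝ) + ε * (t - s - 2) ≤ Q i t
  gap : ∀ i j, j < i → ∀ t, 0 < t → (Q j t : ℝ) + ε * (t - 2) ≤ Q i t

/-- The standing assumptions on the process. -/
structure IsMixingProcess {Ω : Type*} [mΩ : MeasurableSpace Ω] (P : Measure Ω)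
    (𝓕 : EReal → EReal → MeasurableSpace Ω) {d : ℕ}
    (X : ℝ≥0 → Ω → EuclideanSpace ℝ (Fin d)) (μ : Measure (EuclideanSpace ℝ (Fin d))) : Prop where
  measurable_uncurry : Measurable (Function.uncurry X)
  map_eq : ∀ t, P.map (X t) = μ
  le : ∀ s t, s ≤ t → 𝓕 s t ≤ mΩ
  mono : ∀ s t s' t', s ≤ t → s' ≤ s → t ≤ t' → 𝓕 s t ≤ 𝓕 s' t'
  rate : HasMixingRate P 𝓕 X

section

variable {Ω : Type*} [mΩ : MeasurableSpace Ω] {P : Measure Ω}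
  {𝓕 : EReal → EReal → MeasurableSpace Ω} {d ℓ : ℕ}
  {X : ℝ≥0 → Ω → EuclideanSpace ℝ (Fin d)} {μ : Measure (EuclideanSpace ℝ (Fin d))}
  {Q : Fin ℓ → ℝ → ℝ≥0} {ε : ℝ}

namespace IsMixingProcess

theorem measurable (hX : IsMixingProcess P 𝓕 X μ) (t : ℝ≥0) : Measurable (X t) :=
  hX.measurable_uncurry.comp measurable_prodMk_left

theorem isProbabilityMeasure [IsProbabilityMeasure P] (hX : IsMixingProcess P 𝓕 X μ) :
    IsProbabilityMeasure μ :=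
  hX.map_eq 0 ▸ Measure.isProbabilityMeasure_map (hX.measurable 0).aemeasurable

theorem integral_comp (hX : IsMixingProcess P 𝓕 X μ) {g : EuclideanSpace ℝ (Fin d) → ℝ}
    (hg : Measurable g) (t : ℝ≥0) : ∫ ω, g (X t ω) ∂P = ∫ x, g x ∂μ := by
  rw [← hX.map_eq t, integral_map (hX.measurable t).aemeasurable hg.aestronglyMeasurable]

theorem measurable_comp (hX : IsMixingProcess P 𝓕 X μ) {r : ℝ → ℝ≥0} (hr : Measurable r) :
    Measurable fun z : ℝ × Ω => X (r z.1) z.2 :=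
  hX.measurable_uncurry.comp ((hr.comp measurable_fst).prodMk measurable_snd)

theorem measurable_product (hX : IsMixingProcess P 𝓕 X μ) (hQ : IsSeparating Q ε)
    {f : Fin ℓ → EuclideanSpace ℝ (Fin d) → ℝ} (hf : ∀ j, Measurable (f j)) (i : Fin ℓ) :
    Measurable (Function.uncurry fun (s : ℝ) (ω : Ω) =>
      (∏ j with j < i, f j (X (Q j s) ω)) * f i (X (Q i s) ω)) := by
  have h : ∀ j, Measurable fun z : ℝ × Ω => f j (X (Q j z.1) z.2) := fun j =>
    (hf j).comp (hX.measurable_comp (hQ.mono j).measurable)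
  exact (Finset.measurable_prod _ fun j _ => h j).mul (h i)

variable [IsProbabilityMeasure P]

theorem isNearMeasurable (hX : IsMixingProcess P 𝓕 X μ) {f : EuclideanSpace ℝ (Fin d) → ℝ}
    {Λ : ℝ≥0} (hf : LipschitzWith Λ f) (hf1 : ∀ x, |f x| ≤ 1) {q : ℝ≥0∞} (hq : 1 ≤ q)
    (u : ℝ≥0) (n : ℕ) {a b : EReal} (ha : a ≤ ((u - n : ℝ) : EReal))
    (hb : ((u + n : ℝ) : EReal) ≤ b) :
    IsNearMeasurable (𝓕 a b) P (fun ω => f (X u ω)) (Λ * approxRate P 𝓕 X q n) := by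
  have hle : ((u - n : ℝ) : EReal) ≤ ((u + n : ℝ) : EReal) := by
    rw [EReal.coe_le_coe_iff]; linarith [n.cast_nonneg (α := ℝ)]
  obtain ⟨h1, h2, A', h3, h4, h5⟩ := (IsNearMeasurable.comp_of_lipschitz (P := P)
    (hX.le _ _ hle) (hX.measurable u) hf hf1 hq).mono (hX.mono _ _ a b hle ha hb)
  refine ⟨h1, h2, A', h3, h4, h5.trans ?_⟩
  gcongr
  exact le_iSup (fun s : ℝ≥0 => eLpNorm (fun ω => X s ω -
      (P[X s | 𝓕 (((s : ℝ) - n : ℝ) : EReal) (((s : ℝ) + n : ℝ) : EReal)]) ω) q P) u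

/-- The products `∏ j < i, f j (X (q j s)) * f i (X (q i s))` with `f i` centred have correlations
which decay like `|t - s| ^ (-1/2)`, uniformly over the functions `f j` with a given Lipschitz
constant. -/
theorem exists_correlation_le (hX : IsMixingProcess P 𝓕 X μ) (hQ : IsSeparating Q ε) (hε : 0 < ε)
    (Λ : ℝ≥0) :
    ∃ C : ℝ, ∀ f : Fin ℓ → EuclideanSpace ℝ (Fin d) → ℝ, (∀ j, LipschitzWith Λ (f j)) →
      (∀ j x, |f j x| ≤ 1) → ∀ i, ∫ x, f i x ∂μ = 0 → ∀ s t : ℝ, 0 < s → s ≤ t →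
      |∫ ω, ((∏ j with j < i, f j (X (Q j s) ω)) * f i (X (Q i s) ω)) *
        ((∏ j with j < i, f j (X (Q j t) ω)) * f i (X (Q i t) ω)) ∂P| ≤
      C * (√(1 + (t - s)))⁻¹ := by
  obtain ⟨p, q, hp, hq, C, hC, hrate⟩ := hX.rate
  -- At most 2ℓ + 1 past factors cost Λβ each, the future factor costs 2Λβ, and the mixing
  -- coefficient enters with weight 1.
  set M : ℝ := (2 * ℓ + 3) * Λ + 1 with hM
  have hM1 : 1 ≤ M := by rw [hM]; linarith [show 0 ≤ (2 * (ℓ : ℝ) + 3) * Λ by positivity]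
  refine ⟨M * C * √(3 / ε + 3), fun f hf hf1 i hfi s t hs hst => ?_⟩
  -- The lead of q_i(t) over all other arguments is cut into three pieces of length n: one to
  -- approximate the past factors, one as mixing gap, one to approximate the future factor. For t -
  -- s < 2 the floor is 0 and only monotonicity is used.
  set n := ⌊ε * (t - s - 2) / 3⌋₊ with hn
  have hts : 1 + (t - s) ≤ (3 / ε + 3) * (n + 1) := by
    have h := (Nat.lt_floor_add_one (ε * (t - s - 2) / 3)).le
    rw [← hn, div_le_iff₀ three_pos, ← le_div_iff₀' hε] at h
    have e : ((n : ℝ) + 1) * 3 / ε = 3 / ε * (n + 1) := by ring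
    rw [e] at h
    linarith [n.cast_nonneg (α := ℝ)]
  have hfar : ∀ u : ℝ≥0, u ≤ Q i t → (u : ℝ) + ε * (t - s - 2) ≤ Q i t →
      (u : ℝ) + 3 * n ≤ Q i t := by
    intro u h1 h2
    rcases le_total 0 (ε * (t - s - 2) / 3) with h | h
    · have := Nat.floor_le h; rw [← hn] at this; linarith
    · rw [hn, Nat.floor_of_nonpos h]; simpa using h1
  have hsmall : (Q i s : ℝ) + 3 * n ≤ Q i t := hfar _ (hQ.mono i hst) (hQ.growth i s t hs hst)
  -- The past ends at a, which is at least n after every past argument. The future begins at a + n =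
  -- q_i(t) - n.
  set a : ℝ≥0 := ⟨(Q i t : ℝ) - 2 * n, by
    linarith [(Q i s).coe_nonneg, n.cast_nonneg (α := ℝ)]⟩ with ha
  have ha' : (a : ℝ) = Q i t - 2 * n := rfl
  have hpast : ∀ j (u : ℝ≥0), (u : ℝ) + 3 * n ≤ Q i t →
      IsNearMeasurable (𝓕 ⊥ ((a : ℝ) : EReal)) P (fun ω => f j (X u ω))
        (Λ * approxRate P 𝓕 X q n) := fun j u hu =>
    hX.isNearMeasurable (hf j) (hf1 j) hq u n bot_le (by
      rw [EReal.coe_le_coe_iff, ha']; linarith)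
  have hfut : IsNearMeasurable (𝓕 (((a : ℝ) + n : ℝ) : EReal) ⊤) P (fun ω => f i (X (Q i t) ω))
      (Λ * approxRate P 𝓕 X q n) :=
    hX.isNearMeasurable (hf i) (hf1 i) hq _ n (by rw [EReal.coe_le_coe_iff, ha']; linarith) le_top
  have hm : 𝓕 ⊥ ((a : ℝ) : EReal) ≤ mΩ := hX.le _ _ bot_le
  have hA1 := IsNearMeasurable.prod hm (Finset.univ.filter (· < i))
    (A := fun j ω => f j (X (Q j s) ω)) fun j hj => hpast j (Q j s) (by
      have : (Q j s : ℝ) ≤ Q i s := hQ.le_of_lt i j (Finset.mem_filter.1 hj).2 s hs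
      linarith)
  have hA2 := IsNearMeasurable.prod hm (Finset.univ.filter (· < i))
    (A := fun j ω => f j (X (Q j t) ω)) fun j hj => hpast j (Q j t) (by
      have hji := (Finset.mem_filter.1 hj).2
      refine hfar _ (hQ.le_of_lt i j hji t (by linarith)) ?_
      have := hQ.gap i j hji t (by linarith)
      have : ε * (t - s - 2) ≤ ε * (t - 2) := by gcongr; linarith
      linarith)
  have hA := (hA1.mul hm (hpast i _ hsmall)).mul hm hA2
  have hcov := hA.enorm_integral_mul_le (p := p) (q := q) hm (hX.le _ _ le_top) hfut
    (by rw [hX.integral_comp (hf i).continuous.measurable, hfi]) hp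
  set k := (Finset.univ.filter (· < i)).card with hk
  have hkℓ : k ≤ ℓ := (Finset.card_le_univ _).trans_eq (by simp)
  set I := ∫ ω, ((∏ j with j < i, f j (X (Q j s) ω)) * f i (X (Q i s) ω)) *
        ((∏ j with j < i, f j (X (Q j t) ω)) * f i (X (Q i t) ω)) ∂P with hI
  have hIe : I = ∫ ω, ((∏ j with j < i, f j (X (Q j s) ω)) * f i (X (Q i s) ω) *
        ∏ j with j < i, f j (X (Q j t) ω)) * f i (X (Q i t) ω) ∂P := by
    simp only [hI, mul_assoc]
  rw [← hIe] at hcov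
  have hI1 : ‖I‖ₑ ≤ 1 := by
    rw [hIe]
    refine (enorm_integral_le_lintegral_enorm _).trans
      ((lintegral_mono (g := fun _ => 1) fun ω => ?_).trans (by simp))
    exact enorm_le_one_of_abs_le_one (abs_mul_le_one (hA.abs_le_one ω) (hfut.abs_le_one ω))
  have hvar : varpi P q p (𝓕 ⊥ ((a : ℝ) : EReal)) (𝓕 (((a : ℝ) + n : ℝ) : EReal) ⊤) ≤
      mixingRate P 𝓕 q p n :=
    le_iSup (fun s : ℝ≥0 => varpi P q p (𝓕 ⊥ ((s : ℝ) : EReal))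
      (𝓕 (((s : ℝ) + n : ℝ) : EReal) ⊤)) a
  set β := approxRate P 𝓕 X q n
  set ϖ := mixingRate P 𝓕 q p n
  have hMβ : ‖I‖ₑ ≤ ENNReal.ofReal M * (ϖ + β) := by
    have hM' : ENNReal.ofReal M = (2 * ℓ + 3) * Λ + 1 := by
      rw [hM, ENNReal.ofReal_add (by positivity) zero_le_one, ENNReal.ofReal_mul (by positivity),
        ENNReal.ofReal_add (by positivity) (by norm_num), ENNReal.ofReal_mul (by norm_num)]
      simp
    calc ‖I‖ₑ ≤ k * (Λ * β) + Λ * β + k * (Λ * β) + 2 * (Λ * β) + ϖ := by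
          exact hcov.trans (by gcongr)
      _ ≤ ℓ * (Λ * β) + Λ * β + ℓ * (Λ * β) + 2 * (Λ * β) + ϖ := by gcongr
      _ = (2 * ℓ + 3) * Λ * β + 1 * ϖ := by ring
      _ ≤ ((2 * ℓ + 3) * Λ + 1) * β + ((2 * ℓ + 3) * Λ + 1) * ϖ := by
          gcongr
          · exact le_self_add
          · exact le_add_self
      _ = ENNReal.ofReal M * (ϖ + β) := by rw [hM']; ring
  -- The trivial bound |I| ≤ 1 ≤ M takes over where ϖ + β exceeds 1, since the rate is known only
  -- for the minimum.
  have hmin : ‖I‖ₑ ≤ ENNReal.ofReal M * min 1 (ϖ + β) := by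
    rcases le_total 1 (ϖ + β) with h | h
    · rw [min_eq_left h, mul_one]; exact hI1.trans (by simpa using hM1)
    · rw [min_eq_right h]; exact hMβ
  have hfin : ‖I‖ₑ ≤ ENNReal.ofReal (M * (C * (√((n : ℝ) + 1))⁻¹)) := by
    rw [ENNReal.ofReal_mul (by positivity)]
    exact hmin.trans (by gcongr; exact hrate n)
  rw [Real.enorm_eq_ofReal_abs, ENNReal.ofReal_le_ofReal_iff (by positivity)] at hfin
  refine hfin.trans ?_
  rw [← mul_assoc, mul_assoc (M * C)]
  refine mul_le_mul_of_nonneg_left ?_ (by positivity)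
  have h1 : 0 < √(1 + (t - s)) := Real.sqrt_pos.2 (by linarith)
  have h2 : 0 < √((n : ℝ) + 1) := Real.sqrt_pos.2 (by positivity)
  rw [← div_eq_mul_inv, le_div_iff₀ h1, inv_mul_le_iff₀ h2,
    mul_comm, ← Real.sqrt_mul (by positivity)]
  exact Real.sqrt_le_sqrt hts

theorem ae_tendsto_timeAverage_product_zero (hX : IsMixingProcess P 𝓕 X μ)
    (hQ : IsSeparating Q ε) (hε : 0 < ε) {Λ : ℝ≥0}
    {f : Fin ℓ → EuclideanSpace ℝ (Fin d) → ℝ} (hf : ∀ j, LipschitzWith Λ (f j))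
    (hf1 : ∀ j x, |f j x| ≤ 1) (i : Fin ℓ) (hfi : ∫ x, f i x ∂μ = 0) :
    ∀ᵐ ω ∂P, Tendsto (fun T : ℝ => (1 / T) * ∫ s in (0 : ℝ)..T,
      (∏ j with j < i, f j (X (Q j s) ω)) * f i (X (Q i s) ω)) atTop (𝓝 0) := by
  obtain ⟨C, hC⟩ := hX.exists_correlation_le hQ hε Λ
  refine ae_tendsto_timeAverage_zero
    (hX.measurable_product hQ (fun j => (hf j).continuous.measurable) i) (fun s ω => ?_)
    (hC f hf hf1 i hfi)
  refine abs_mul_le_one ?_ (hf1 _ _)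
  rw [Finset.abs_prod]
  exact Finset.prod_le_one (fun _ _ => abs_nonneg _) fun j _ => hf1 j _

/-- The strong law of large numbers for products of bounded Lipschitz functions. -/
theorem ae_tendsto_timeAverage_prod (hX : IsMixingProcess P 𝓕 X μ)
    (hQ : IsSeparating Q ε) (hε : 0 < ε) {Λ : ℝ≥0}
    {f : Fin ℓ → EuclideanSpace ℝ (Fin d) → ℝ} (hf : ∀ j, LipschitzWith Λ (f j))
    (hf1 : ∀ j x, |f j x| ≤ 1) :
    ∀ᵐ ω ∂P, Tendsto (fun T : ℝ => (1 / T) * ∫ s in (0 : ℝ)..T, ∏ j, f j (X (Q j s) ω)) atTop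
      (𝓝 (∫ x, ∏ j, f j (x j) ∂(Measure.pi fun _ : Fin ℓ => μ))) := by
  have := hX.isProbabilityMeasure
  set c : Fin ℓ → ℝ := fun j => ∫ x, f j x ∂μ with hc
  have hc1 : ∀ j, |c j| ≤ 1 := fun j => by
    have := norm_integral_le_of_norm_le_const (μ := μ) (f := f j) (C := 1)
      (Eventually.of_forall (hf1 j))
    simpa using this
  -- the `i`-th function is centred and scaled
  set g : Fin ℓ → Fin ℓ → EuclideanSpace ℝ (Fin d) → ℝ := fun i j =>
    if j = i then fun x => (f j x - c j) / 2 else f j with hg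
  have hgL : ∀ i j, LipschitzWith Λ (g i j) := by
    intro i j
    by_cases h : j = i
    · simp only [hg, h, if_true]
      refine LipschitzWith.of_dist_le_mul fun x y => ?_
      have := (hf i).dist_le_mul x y
      rw [Real.dist_eq] at this ⊢
      rw [show (f i x - c i) / 2 - (f i y - c i) / 2 = (f i x - f i y) / 2 by ring, abs_div,
        abs_two]
      linarith [abs_nonneg (f i x - f i y)]
    · simpa only [hg, h, if_false] using hf j
  have hg1 : ∀ i j x, |g i j x| ≤ 1 := by
    intro i j x
    by_cases h : j = i
    · simp only [hg, h, if_true]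
      rw [abs_div, abs_two]
      linarith [abs_sub (f i x) (c i), hf1 i x, hc1 i]
    · simpa only [hg, h, if_false] using hf1 j x
  have hfint : ∀ j, Integrable (f j) μ := fun j =>
    integrable_of_abs_le_one (hf j).continuous.measurable (hf1 j)
  have hg0 : ∀ i, ∫ x, g i i x ∂μ = 0 := by
    intro i
    simp only [hg, if_true]
    rw [integral_div, integral_sub (hfint i) (integrable_const _)]
    simp [hc]
  have hae := ae_all_iff.2 fun i =>
    hX.ae_tendsto_timeAverage_product_zero hQ hε (hgL i) (hg1 i) i (hg0 i)
  filter_upwards [hae] with ω hω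
  rw [integral_fintype_prod_eq_prod]
  have hmeas : ∀ i j, Measurable fun s => g i j (X (Q j s) ω) := fun i j =>
    (hgL i j).continuous.measurable.comp
      ((hX.measurable_comp (hQ.mono j).measurable).comp measurable_prodMk_right)
  have hii : ∀ i (T : ℝ), IntervalIntegrable (fun s =>
      (∏ j with j < i, g i j (X (Q j s) ω)) * g i i (X (Q i s) ω)) volume 0 T := by
    intro i T
    refine (intervalIntegrable_const (c := (1 : ℝ))).mono_fun
      ((Finset.measurable_prod _ fun j _ => hmeas i j).mul (hmeas i i)).aestronglyMeasurable
      (Eventually.of_forall fun s => ?_)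
    rw [norm_one]
    refine abs_mul_le_one ?_ (hg1 _ _ _)
    rw [Finset.abs_prod]
    exact Finset.prod_le_one (fun _ _ => abs_nonneg _) fun j _ => hg1 i j _
  -- Telescoping expansion of ∏ (c j - (c j - f j)): factors below i are kept, those above i are
  -- replaced by their means. The 2 undoes the halving that kept the centred factor in [-1, 1].
  have key : ∀ s, ∏ j, f j (X (Q j s) ω) = ∏ j, c j + ∑ i, (2 * ∏ j with i < j, c j) *
      ((∏ j with j < i, g i j (X (Q j s) ω)) * g i i (X (Q i s) ω)) := by
    intro s
    have h := Finset.prod_sub_ordered Finset.univ c fun j => c j - f j (X (Q j s) ω)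
    simp only [sub_sub_cancel] at h
    rw [h, sub_eq_add_neg, ← Finset.sum_neg_distrib]
    congr 1
    refine Finset.sum_congr rfl fun i _ => ?_
    have e : ∏ j with j < i, g i j (X (Q j s) ω) = ∏ j with j < i, f j (X (Q j s) ω) := by
      refine Finset.prod_congr rfl fun j hj => ?_
      simp only [hg, (Finset.mem_filter.1 hj).2.ne, if_false]
    rw [e]
    simp only [hg, if_true]
    ring
  have hlim : Tendsto (fun T : ℝ => ∏ j, c j + ∑ i, (2 * ∏ j with i < j, c j) *
      ((1 / T) * ∫ s in (0 : ℝ)..T, (∏ j with j < i, g i j (X (Q j s) ω)) * g i i (X (Q i s) ω)))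
      atTop (𝓝 (∏ j, c j)) := by
    have := (tendsto_finsetSum Finset.univ fun i _ =>
      (hω i).const_mul (2 * ∏ j with i < j, c j)).const_add (∏ j, c j)
    simpa using this
  refine hlim.congr' ?_
  filter_upwards [eventually_gt_atTop 0] with T hT
  simp only [key]
  have hsum : IntervalIntegrable (fun s => ∑ i, (2 * ∏ j with i < j, c j) *
      ((∏ j with j < i, g i j (X (Q j s) ω)) * g i i (X (Q i s) ω))) volume 0 T := by
    have h := IntervalIntegrable.sum Finset.univ fun i _ =>
      (hii i T).const_mul (2 * ∏ j with i < j, c j)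
    rwa [show (∑ i, fun s => (2 * ∏ j with i < j, c j) *
      ((∏ j with j < i, g i j (X (Q j s) ω)) * g i i (X (Q i s) ω))) = fun s => ∑ i,
        (2 * ∏ j with i < j, c j) * ((∏ j with j < i, g i j (X (Q j s) ω)) *
          g i i (X (Q i s) ω)) by ext s; simp] at h
  rw [intervalIntegral.integral_add intervalIntegrable_const hsum,
    intervalIntegral.integral_finsetSum fun i _ => (hii i T).const_mul _, mul_add, Finset.mul_sum]
  simp only [intervalIntegral.integral_const_mul, intervalIntegral.integral_const, sub_zero,
    smul_eq_mul]
  rw [← mul_assoc, one_div, inv_mul_cancel₀ hT.ne', one_mul]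
  congr 1
  exact Finset.sum_congr rfl fun i _ => by ring

end IsMixingProcess

end

/-! ### Approximation by products of bounded Lipschitz functions -/

/-- The bounded Lipschitz functions of one coordinate. -/
def coordLipschitz (ℓ d : ℕ) : Set C(Fin ℓ → EuclideanSpace ℝ (Fin d), ℝ) :=
  {φ | ∃ (j : Fin ℓ) (f : EuclideanSpace ℝ (Fin d) → ℝ) (Λ : ℝ≥0), LipschitzWith Λ f ∧
    (∀ x, |f x| ≤ 1) ∧ ∀ x, φ x = f (x j)}

section

variable {ℓ d : ℕ}

/-- Factors depending on the same coordinate can be merged, because products of bounded Lipschitz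
functions are bounded Lipschitz. The algebra is thus spanned by products with one factor per
coordinate. -/
theorem exists_eq_prod_of_mem_closure {φ : C(Fin ℓ → EuclideanSpace ℝ (Fin d), ℝ)}
    (hφ : φ ∈ Submonoid.closure (coordLipschitz ℓ d)) :
    ∃ (f : Fin ℓ → EuclideanSpace ℝ (Fin d) → ℝ) (Λ : ℝ≥0), (∀ j, LipschitzWith Λ (f j)) ∧
      (∀ j x, |f j x| ≤ 1) ∧ ∀ x, φ x = ∏ j, f j (x j) := by
  induction hφ using Submonoid.closure_induction with
  | mem φ h =>
    obtain ⟨i, f, Λ, h1, h2, h3⟩ := h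
    refine ⟨fun j => if j = i then f else fun _ => 1, Λ, fun j => ?_, fun j x => ?_, fun x => ?_⟩
    · by_cases h : j = i
      · simpa [h] using h1
      · simpa [h] using LipschitzWith.const' (K := Λ) (1 : ℝ)
    · by_cases h : j = i
      · simpa [h] using h2 x
      · simp [h]
    · rw [h3, Finset.prod_eq_single i]
      · simp
      · intro j _ hj; simp [hj]
      · simp
  | one => exact ⟨fun _ _ => 1, 0, fun j => LipschitzWith.const 1, by simp, by simp⟩
  | mul φ ψ _ _ h h' =>
    obtain ⟨f, Λ, h1, h2, h3⟩ := h
    obtain ⟨g, Λ', h1', h2', h3'⟩ := h'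
    refine ⟨fun j x => f j x * g j x, Λ + Λ', fun j => ?_,
      fun j x => abs_mul_le_one (h2 j x) (h2' j x), fun x => ?_⟩
    · refine LipschitzWith.of_dist_le_mul fun x y => ?_
      have a := (h1 j).dist_le_mul x y
      have b := (h1' j).dist_le_mul x y
      rw [Real.dist_eq] at a b ⊢
      rw [show f j x * g j x - f j y * g j y
        = (f j x - f j y) * g j x + f j y * (g j x - g j y) by ring]
      refine (abs_add_le _ _).trans ?_
      rw [abs_mul, abs_mul, NNReal.coe_add, add_mul]
      exact add_le_add ((mul_le_of_le_one_right (abs_nonneg _) (h2' j x)).trans a)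
        ((mul_le_of_le_one_left (abs_nonneg _) (h2 j y)).trans b)
    · rw [ContinuousMap.mul_apply, h3, h3', Finset.prod_mul_distrib]

theorem coordLipschitz_separatesPoints :
    (Algebra.adjoin ℝ (coordLipschitz ℓ d)).SeparatesPoints := by
  intro x y hxy
  obtain ⟨j, hj⟩ := Function.ne_iff.1 hxy
  have hL : LipschitzWith 1 fun z : EuclideanSpace ℝ (Fin d) => min (dist z (x j)) 1 :=
    (LipschitzWith.dist_left (x j)).min_const 1
  refine ⟨fun z => min (dist (z j) (x j)) 1,
    ⟨⟨_, hL.continuous.comp (continuous_apply j)⟩, Algebra.subset_adjoin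
      ⟨j, _, 1, hL, fun z => ?_, fun z => rfl⟩, rfl⟩, ?_⟩
  · rw [abs_of_nonneg (by positivity)]; exact min_le_right _ _
  · have : 0 < min (dist (y j) (x j)) 1 := lt_min (dist_pos.2 hj.symm) one_pos
    simpa using this.ne

/-- Stone–Weierstrass gives no control off a compact set. A cutoff that itself belongs to the
algebra removes the far region without leaving the algebra. -/
theorem exists_cutoff (M : ℝ) :
    ∃ χ ∈ Algebra.adjoin ℝ (coordLipschitz ℓ d), (∀ x, 0 ≤ χ x ∧ χ x ≤ 1) ∧
      (∀ x, (∀ j, ‖x j‖ ≤ M) → χ x = 1) ∧ ∀ x j, M + 1 ≤ ‖x j‖ → χ x = 0 := by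
  set f : EuclideanSpace ℝ (Fin d) → ℝ := fun z => max (min (M + 1 - ‖z‖) 1) 0 with hf
  have hf0 : ∀ z, 0 ≤ f z := fun z => le_max_right _ _
  have hf1 : ∀ z, f z ≤ 1 := fun z => max_le (min_le_right _ _) zero_le_one
  have hL : LipschitzWith 1 f := by
    have h : LipschitzWith 1 fun z : EuclideanSpace ℝ (Fin d) => M + 1 - ‖z‖ := by
      refine LipschitzWith.of_dist_le_mul fun x y => ?_
      rw [Real.dist_eq, dist_eq_norm,
        show M + 1 - ‖x‖ - (M + 1 - ‖y‖) = -(‖x‖ - ‖y‖) by ring, abs_neg]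
      simpa using abs_norm_sub_norm_le x y
    exact (h.min_const 1).max_const 0
  set φ : Fin ℓ → C(Fin ℓ → EuclideanSpace ℝ (Fin d), ℝ) := fun j =>
    ⟨fun x => f (x j), hL.continuous.comp (continuous_apply j)⟩ with hφ
  have hval : ∀ x, (∏ j, φ j) x = ∏ j, f (x j) := fun x => by
    rw [ContinuousMap.prod_apply]; rfl
  refine ⟨∏ j, φ j, prod_mem fun j _ => Algebra.subset_adjoin
    ⟨j, f, 1, hL, fun x => ?_, fun x => rfl⟩, fun x => ⟨?_, ?_⟩, fun x hx => ?_,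
    fun x j hx => ?_⟩
  · rw [abs_of_nonneg (hf0 x)]; exact hf1 x
  · rw [hval]; exact Finset.prod_nonneg fun j _ => hf0 _
  · rw [hval]; exact Finset.prod_le_one (fun j _ => hf0 _) fun j _ => hf1 _
  · rw [hval]
    refine Finset.prod_eq_one fun j _ => ?_
    simp only [hf]
    rw [min_eq_right (by linarith [hx j]), max_eq_left zero_le_one]
  · rw [hval]
    refine Finset.prod_eq_zero (Finset.mem_univ j) ?_
    simp only [hf]
    exact max_eq_right ((min_le_left _ _).trans (by linarith))

theorem rpow_le_pow_div {r M ι : ℝ} {N : ℕ} (hM : 1 ≤ M) (hr : M ≤ r) (hN : ι + 1 ≤ N) :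
    r ^ ι ≤ r ^ N / M := by
  have hr0 : 0 < r := by linarith
  rw [le_div_iff₀ (by linarith)]
  calc r ^ ι * M ≤ r ^ ι * r := by gcongr
    _ = r ^ (ι + 1) := by rw [Real.rpow_add_one hr0.ne']
    _ ≤ r ^ (N : ℝ) := Real.rpow_le_rpow_of_exponent_le (hM.trans hr) hN
    _ = r ^ N := Real.rpow_natCast r N

/-- A continuous function of polynomial growth is approximated, with respect to a polynomial
weight, by elements of the algebra generated by the bounded Lipschitz functions of one
coordinate. -/
theorem exists_mem_adjoin_near {F : (Fin ℓ → EuclideanSpace ℝ (Fin d)) → ℝ} (hF : Continuous F)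
    {K ι : ℝ} (hι : 0 < ι) (hK : 0 < K) (hFg : ∀ x, |F x| ≤ K * (1 + ∑ j, ‖x j‖ ^ ι))
    {N : ℕ} (hN : ι + 1 ≤ N) {e : ℝ} (he : 0 < e) :
    ∃ g ∈ Algebra.adjoin ℝ (coordLipschitz ℓ d), ∀ x, |F x - g x| ≤ e * (1 + ∑ j, ‖x j‖ ^ N) := by
  -- M is large enough that K(1 + ℓ) ≤ eM, so the growth of F beyond radius M is absorbed by e times
  -- the weight.
  set M : ℝ := max 1 (K * (1 + ℓ) / e) with hM
  have hM1 : 1 ≤ M := le_max_left _ _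
  have hMe : K * (1 + ℓ) ≤ e * M := by
    rw [← div_le_iff₀' he]; exact le_max_right _ _
  obtain ⟨χ, hχ, hχ01, hχ1, hχ0⟩ := exists_cutoff (ℓ := ℓ) (d := d) M
  have hcomp : IsCompact (Set.univ.pi fun _ : Fin ℓ =>
      Metric.closedBall (0 : EuclideanSpace ℝ (Fin d)) (M + 1)) :=
    isCompact_univ_pi fun _ => isCompact_closedBall _ _
  obtain ⟨g, hg, hgF⟩ :=
    ContinuousMap.exists_mem_subalgebra_near_continuous_of_isCompact_of_separatesPoints
      coordLipschitz_separatesPoints ⟨F, hF⟩ hcomp he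
  refine ⟨g * χ, mul_mem hg hχ, fun x => ?_⟩
  rw [ContinuousMap.mul_apply]
  set U := ∑ j, ‖x j‖ ^ N with hU
  have h1 : |(F x - g x) * χ x| ≤ e := by
    rw [abs_mul, abs_of_nonneg (hχ01 x).1]
    by_cases hx : ∀ j, ‖x j‖ ≤ M + 1
    · have := hgF x fun j _ => by simpa using hx j
      rw [ContinuousMap.coe_mk, Real.norm_eq_abs, abs_sub_comm] at this
      exact (mul_le_of_le_one_right (abs_nonneg _) (hχ01 x).2).trans this.le
    · push Not at hx
      obtain ⟨j, hj⟩ := hx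
      rw [hχ0 x j hj.le, mul_zero]; exact he.le
  have hU0 : ∀ j, 0 ≤ ‖x j‖ ^ N := fun j => by positivity
  -- This is nonzero only if some coordinate exceeds M. Then 1 and every ‖x_j‖^ι are at most U/M, so
  -- |F x| ≤ K(1 + ℓ)U/M ≤ eU.
  have h2 : |F x * (1 - χ x)| ≤ e * U := by
    rw [abs_mul, abs_of_nonneg (sub_nonneg.2 (hχ01 x).2)]
    by_cases hx : ∀ j, ‖x j‖ ≤ M
    · rw [hχ1 x hx, sub_self, mul_zero]
      exact mul_nonneg he.le (Finset.sum_nonneg fun j _ => hU0 j)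
    · push Not at hx
      obtain ⟨i, hi⟩ := hx
      have hle : ∀ j, ‖x j‖ ^ N / M ≤ U / M := fun j => by
        gcongr; exact Finset.single_le_sum (fun j _ => hU0 j) (Finset.mem_univ j)
      have hMU : M ^ ι ≤ U / M :=
        (Real.rpow_le_rpow (by linarith) hi.le hι.le).trans
          ((rpow_le_pow_div hM1 hi.le hN).trans (hle i))
      have hall : ∀ j, ‖x j‖ ^ ι ≤ U / M := by
        intro j
        rcases le_total ‖x j‖ M with h | h
        · exact (Real.rpow_le_rpow (norm_nonneg _) h hι.le).trans hMU
        · exact (rpow_le_pow_div hM1 h hN).trans (hle j)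
      have hone : 1 ≤ U / M := (Real.one_le_rpow hM1 hι.le).trans hMU
      have hsum : ∑ j, ‖x j‖ ^ ι ≤ ℓ * (U / M) := by
        refine (Finset.sum_le_card_nsmul _ _ _ fun j _ => hall j).trans_eq ?_
        rw [Finset.card_univ, Fintype.card_fin, nsmul_eq_mul]
      have heM : e * M * (U / M) = e * U := by
        rw [mul_assoc, mul_div_cancel₀ _ (by linarith : M ≠ 0)]
      refine (mul_le_of_le_one_right (abs_nonneg _) (by linarith [(hχ01 x).1])).trans ?_
      rw [← heM]
      refine ((hFg x).trans ?_).trans (mul_le_mul_of_nonneg_right hMe (zero_le_one.trans hone))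
      rw [mul_assoc]
      exact mul_le_mul_of_nonneg_left (by linarith) hK.le
  calc |F x - g x * χ x| = |(F x - g x) * χ x + F x * (1 - χ x)| := by congr 1; ring
    _ ≤ e + e * U := (abs_add_le _ _).trans (add_le_add h1 h2)
    _ = _ := by ring

end

/-! ### Time averages of functions in the algebra -/

section

variable {Ω : Type*} [mΩ : MeasurableSpace Ω] {P : Measure Ω}
  {𝓕 : EReal → EReal → MeasurableSpace Ω} {d ℓ : ℕ}
  {X : ℝ≥0 → Ω → EuclideanSpace ℝ (Fin d)} {μ : Measure (EuclideanSpace ℝ (Fin d))}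
  {Q : Fin ℓ → ℝ → ℝ≥0} {ε : ℝ}

theorem intervalIntegrable_of_bounded {y : ℝ → ℝ} (hy : Measurable y) {B : ℝ}
    (hB : ∀ s, |y s| ≤ B) (a b : ℝ) : IntervalIntegrable y volume a b :=
  (intervalIntegrable_const (c := B)).mono_fun hy.aestronglyMeasurable
    (Eventually.of_forall fun s => (hB s).trans (le_abs_self B))

theorem IsMixingProcess.measurable_path (hX : IsMixingProcess P 𝓕 X μ) (hQ : IsSeparating Q ε)
    {F : (Fin ℓ → EuclideanSpace ℝ (Fin d)) → ℝ} (hF : Continuous F) (ω : Ω) :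
    Measurable fun s => F fun j => X (Q j s) ω :=
  hF.measurable.comp (measurable_pi_lambda _ fun j =>
    (hX.measurable_comp (hQ.mono j).measurable).comp measurable_prodMk_right)

theorem exists_bound_of_mem_adjoin {g : C(Fin ℓ → EuclideanSpace ℝ (Fin d), ℝ)}
    (hg : g ∈ Algebra.adjoin ℝ (coordLipschitz ℓ d)) : ∃ B : ℝ, ∀ x, |g x| ≤ B := by
  induction hg using Algebra.adjoin_induction with
  | mem φ h =>
    obtain ⟨j, f, Λ, -, h2, h3⟩ := h
    exact ⟨1, fun x => by rw [h3]; exact h2 _⟩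
  | algebraMap r => exact ⟨|r|, fun x => le_rfl⟩
  | add φ ψ _ _ h h' =>
    obtain ⟨B, hB⟩ := h
    obtain ⟨B', hB'⟩ := h'
    exact ⟨B + B', fun x => (abs_add_le _ _).trans (add_le_add (hB x) (hB' x))⟩
  | mul φ ψ _ _ h h' =>
    obtain ⟨B, hB⟩ := h
    obtain ⟨B', hB'⟩ := h'
    refine ⟨B * B', fun x => ?_⟩
    rw [ContinuousMap.mul_apply, abs_mul]
    exact mul_le_mul (hB x) (hB' x) (abs_nonneg _) ((abs_nonneg _).trans (hB x))

theorem integrable_of_mem_adjoin {ν : Measure (Fin ℓ → EuclideanSpace ℝ (Fin d))}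
    [IsFiniteMeasure ν] {g : C(Fin ℓ → EuclideanSpace ℝ (Fin d), ℝ)}
    (hg : g ∈ Algebra.adjoin ℝ (coordLipschitz ℓ d)) : Integrable g ν :=
  let ⟨B, hB⟩ := exists_bound_of_mem_adjoin hg
  Integrable.of_bound g.continuous.aestronglyMeasurable B (Eventually.of_forall hB)

theorem IsMixingProcess.ae_tendsto_of_mem_adjoin [IsProbabilityMeasure P]
    (hX : IsMixingProcess P 𝓕 X μ)
    (hQ : IsSeparating Q ε) (hε : 0 < ε) {g : C(Fin ℓ → EuclideanSpace ℝ (Fin d), ℝ)}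
    (hg : g ∈ Algebra.adjoin ℝ (coordLipschitz ℓ d)) :
    ∀ᵐ ω ∂P, Tendsto (fun T : ℝ => (1 / T) * ∫ s in (0 : ℝ)..T, g fun j => X (Q j s) ω) atTop
      (𝓝 (∫ x, g x ∂(Measure.pi fun _ : Fin ℓ => μ))) := by
  have := hX.isProbabilityMeasure
  have hspan : ∀ φ : C(Fin ℓ → EuclideanSpace ℝ (Fin d), ℝ),
      φ ∈ Submodule.span ℝ (Submonoid.closure (coordLipschitz ℓ d) :
        Set C(Fin ℓ → EuclideanSpace ℝ (Fin d), ℝ)) ↔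
      φ ∈ Algebra.adjoin ℝ (coordLipschitz ℓ d) := fun φ => by
    rw [← Algebra.adjoin_eq_span, Subalgebra.mem_toSubmodule]
  have hii : ∀ φ ∈ Algebra.adjoin ℝ (coordLipschitz ℓ d), ∀ ω (T : ℝ),
      IntervalIntegrable (fun s => φ fun j => X (Q j s) ω) volume 0 T := fun φ hφ ω T =>
    let ⟨_, hB⟩ := exists_bound_of_mem_adjoin hφ
    intervalIntegrable_of_bounded (hX.measurable_path hQ φ.continuous ω) (fun s => hB _) 0 T
  rw [← hspan] at hg
  induction hg using Submodule.span_induction with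
  | mem φ h =>
    obtain ⟨f, Λ, h1, h2, h3⟩ := exists_eq_prod_of_mem_closure h
    simpa only [h3] using hX.ae_tendsto_timeAverage_prod hQ hε h1 h2
  | zero => simp
  | add φ ψ hφ hψ h h' =>
    rw [hspan] at hφ hψ
    filter_upwards [h, h'] with ω h1 h2
    simp only [ContinuousMap.add_apply]
    rw [integral_add (integrable_of_mem_adjoin hφ) (integrable_of_mem_adjoin hψ)]
    refine (h1.add h2).congr fun T => ?_
    rw [intervalIntegral.integral_add (hii φ hφ ω T) (hii ψ hψ ω T), mul_add]
  | smul c φ hφ h =>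
    filter_upwards [h] with ω h1
    simp only [ContinuousMap.smul_apply, smul_eq_mul]
    rw [integral_const_mul]
    refine (h1.const_mul c).congr fun T => ?_
    rw [intervalIntegral.integral_const_mul]; ring

end

/-! ### Averages of powers of the norm -/

/-- The truncated power `min (‖x‖ / R) 1 ^ N`. -/
noncomputable def truncPow {E : Type*} [Norm E] (N : ℕ) (R : ℝ) (x : E) : ℝ := min (‖x‖ / R) 1 ^ N

section

variable {E : Type*} [NormedAddCommGroup E] {N : ℕ} {R : ℝ}

theorem truncPow_nonneg (hR : 1 ≤ R) (x : E) : 0 ≤ truncPow N R x :=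
  pow_nonneg (le_min (by positivity) zero_le_one) N

theorem truncPow_le_one (hR : 1 ≤ R) (x : E) : truncPow N R x ≤ 1 :=
  pow_le_one₀ (le_min (by positivity) zero_le_one) (min_le_right _ _)

/-- Dividing by R before truncating makes the Lipschitz constant N independent of R ≥ 1, so one
correlation constant serves all truncation levels. -/
theorem lipschitzWith_truncPow (hR : 1 ≤ R) : LipschitzWith N (truncPow N R : E → ℝ) := by
  have hR0 : 0 < R := by linarith
  refine LipschitzWith.of_dist_le_mul fun x y => ?_
  have h01 : ∀ z : E, |min (‖z‖ / R) 1| ≤ 1 := fun z => by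
    rw [abs_of_nonneg (le_min (by positivity) zero_le_one)]; exact min_le_right _ _
  have h1 : |min (‖x‖ / R) 1 - min (‖y‖ / R) 1| ≤ dist x y := by
    refine (abs_min_sub_min_le_max _ _ _ _).trans ?_
    rw [sub_self, abs_zero, max_eq_left (abs_nonneg _), ← sub_div, abs_div, abs_of_pos hR0,
      dist_eq_norm]
    exact (div_le_self (abs_nonneg _) hR).trans (abs_norm_sub_norm_le x y)
  rw [Real.dist_eq]
  refine (abs_pow_sub_pow_le _ _ N).trans ?_
  have h2 : max |min (‖x‖ / R) 1| |min (‖y‖ / R) 1| ^ (N - 1) ≤ 1 :=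
    pow_le_one₀ ((abs_nonneg _).trans (le_max_left _ _)) (max_le (h01 x) (h01 y))
  refine (mul_le_of_le_one_right (by positivity) h2).trans ?_
  rw [mul_comm, NNReal.coe_natCast]
  gcongr

theorem pow_mul_truncPow (hR : 1 ≤ R) (x : E) : R ^ N * truncPow N R x = min ‖x‖ R ^ N := by
  have hR0 : 0 < R := by linarith
  rw [truncPow, ← mul_pow, mul_min_of_nonneg _ _ hR0.le, mul_one, mul_div_cancel₀ _ hR0.ne']

theorem pow_mul_truncPow_le (hR : 1 ≤ R) (x : E) : R ^ N * truncPow N R x ≤ ‖x‖ ^ N := by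
  rw [pow_mul_truncPow hR]
  exact pow_le_pow_left₀ (le_min (norm_nonneg _) (by linarith)) (min_le_left _ _) N

/-- Where truncation acts, ‖x‖²/R² ≥ 1. The two extra powers give a factor R^(-2), summable at R = k
+ 1. -/
theorem norm_pow_sub_le (hR : 1 ≤ R) (x : E) :
    ‖x‖ ^ N - R ^ N * truncPow N R x ≤ ‖x‖ ^ (N + 2) * (R ^ 2)⁻¹ := by
  have hR0 : 0 < R := by linarith
  rw [pow_mul_truncPow hR]
  rcases le_total ‖x‖ R with h | h
  · rw [min_eq_left h, sub_self]; positivity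
  · have h1 : 0 ≤ min ‖x‖ R ^ N := pow_nonneg (le_min (norm_nonneg _) hR0.le) N
    have h2 : R ^ 2 ≤ ‖x‖ ^ 2 := by gcongr
    rw [← div_eq_mul_inv, le_div_iff₀ (by positivity), pow_add]
    have h3 : 0 ≤ ‖x‖ ^ N := by positivity
    nlinarith

end

section

variable {Ω : Type*} [mΩ : MeasurableSpace Ω] {P : Measure Ω}
  {𝓕 : EReal → EReal → MeasurableSpace Ω} {d ℓ : ℕ}
  {X : ℝ≥0 → Ω → EuclideanSpace ℝ (Fin d)} {μ : Measure (EuclideanSpace ℝ (Fin d))}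
  {Q : Fin ℓ → ℝ → ℝ≥0} {ε : ℝ}

namespace IsMixingProcess

theorem integrable_comp (hX : IsMixingProcess P 𝓕 X μ) {h : EuclideanSpace ℝ (Fin d) → ℝ}
    (hh : Integrable h μ) (t : ℝ≥0) : Integrable (fun ω => h (X t ω)) P := by
  have h1 : Integrable h (P.map (X t)) := by rwa [hX.map_eq t]
  exact h1.comp_measurable (hX.measurable t)

variable [IsProbabilityMeasure P]

theorem integrable_prod (hX : IsMixingProcess P 𝓕 X μ) {h : EuclideanSpace ℝ (Fin d) → ℝ}
    (hm : Measurable h) (hh : Integrable h μ) {r : ℝ → ℝ≥0} (hr : Measurable r) (T : ℝ) :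
    Integrable (fun z : ℝ × Ω => h (X (r z.1) z.2)) ((volume.restrict (Set.Ioc 0 T)).prod P) := by
  have hmeas : Measurable fun z : ℝ × Ω => h (X (r z.1) z.2) := hm.comp (hX.measurable_comp hr)
  rw [integrable_prod_iff hmeas.aestronglyMeasurable]
  refine ⟨Eventually.of_forall fun s => hX.integrable_comp hh (r s), ?_⟩
  simp_rw [hX.integral_comp hm.norm]
  exact integrable_const _

theorem ae_intervalIntegrable (hX : IsMixingProcess P 𝓕 X μ) {h : EuclideanSpace ℝ (Fin d) → ℝ}
    (hm : Measurable h) (hh : Integrable h μ) {r : ℝ → ℝ≥0} (hr : Measurable r) :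
    ∀ᵐ ω ∂P, ∀ T : ℝ, 0 ≤ T → IntervalIntegrable (fun s => h (X (r s) ω)) volume 0 T := by
  have h1 : ∀ᵐ ω ∂P, ∀ n : ℕ, Integrable (fun s => h (X (r s) ω))
      (volume.restrict (Set.Ioc 0 (n : ℝ))) :=
    ae_all_iff.2 fun n => (hX.integrable_prod hm hh hr n).prod_left_ae
  filter_upwards [h1] with ω hω T hT
  obtain ⟨n, hn⟩ := exists_nat_ge T
  rw [intervalIntegrable_iff_integrableOn_Ioc_of_le hT]
  exact IntegrableOn.mono_set (hω n) (Set.Ioc_subset_Ioc_right hn)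

theorem integrable_timeIntegral (hX : IsMixingProcess P 𝓕 X μ)
    {h : EuclideanSpace ℝ (Fin d) → ℝ} (hm : Measurable h) (hh : Integrable h μ)
    {r : ℝ → ℝ≥0} (hr : Measurable r) {T : ℝ} (hT : 0 ≤ T) :
    Integrable (fun ω => ∫ s in (0 : ℝ)..T, h (X (r s) ω)) P := by
  simp_rw [intervalIntegral.integral_of_le hT]
  exact (hX.integrable_prod hm hh hr T).integral_prod_right

theorem integral_timeIntegral (hX : IsMixingProcess P 𝓕 X μ)
    {h : EuclideanSpace ℝ (Fin d) → ℝ} (hm : Measurable h) (hh : Integrable h μ)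
    {r : ℝ → ℝ≥0} (hr : Measurable r) {T : ℝ} (hT : 0 ≤ T) :
    ∫ ω, (∫ s in (0 : ℝ)..T, h (X (r s) ω)) ∂P = T * ∫ x, h x ∂μ := by
  simp_rw [intervalIntegral.integral_of_le hT]
  rw [← integral_integral_swap (hX.integrable_prod hm hh hr T)]
  simp_rw [hX.integral_comp hm]
  simp [hT, measureReal_def]

/-- The second moments of centred averages of truncated powers, uniformly in the truncation. -/
theorem exists_integral_sq_truncPow_le (hX : IsMixingProcess P 𝓕 X μ) (hQ : IsSeparating Q ε)
    (hε : 0 < ε) (i : Fin ℓ) (N : ℕ) :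
    ∃ C : ℝ, ∀ R : ℝ, 1 ≤ R → ∀ T : ℝ, 1 ≤ T →
      Integrable (fun ω => (1 / T * ∫ s in (0 : ℝ)..T,
        (truncPow N R (X (Q i s) ω) - ∫ x, truncPow N R x ∂μ) / 2) ^ 2) P ∧
      ∫ ω, (1 / T * ∫ s in (0 : ℝ)..T,
        (truncPow N R (X (Q i s) ω) - ∫ x, truncPow N R x ∂μ) / 2) ^ 2 ∂P ≤ C * (√T)⁻¹ := by
  have := hX.isProbabilityMeasure
  obtain ⟨C, hC⟩ := hX.exists_correlation_le hQ hε N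
  refine ⟨8 * C, fun R hR T hT => ?_⟩
  set c := ∫ x, truncPow N R x ∂μ with hc
  have hL := lipschitzWith_truncPow (E := EuclideanSpace ℝ (Fin d)) (N := N) hR
  have habs : ∀ x : EuclideanSpace ℝ (Fin d), |truncPow N R x| ≤ 1 := fun x => by
    rw [abs_of_nonneg (truncPow_nonneg hR x)]; exact truncPow_le_one hR x
  have hc1 : |c| ≤ 1 := by
    have := norm_integral_le_of_norm_le_const (μ := μ) (C := 1) (f := truncPow N R)
      (Eventually.of_forall habs)
    simpa using this
  set g : EuclideanSpace ℝ (Fin d) → ℝ := fun x => (truncPow N R x - c) / 2 with hg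
  have hgL : LipschitzWith N g := by
    refine LipschitzWith.of_dist_le_mul fun x y => ?_
    have := hL.dist_le_mul x y
    rw [Real.dist_eq] at this ⊢
    rw [show g x - g y = (truncPow N R x - truncPow N R y) / 2 by simp only [hg]; ring, abs_div,
      abs_two]
    linarith [abs_nonneg (truncPow N R x - truncPow N R y)]
  have hg1 : ∀ x, |g x| ≤ 1 := fun x => by
    simp only [hg]
    rw [abs_div, abs_two]
    linarith [abs_sub (truncPow N R x) c, habs x]
  have hg0 : ∫ x, g x ∂μ = 0 := by
    simp only [hg]
    rw [integral_div, integral_sub (integrable_of_abs_le_one hL.continuous.measurable habs)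
      (integrable_const _)]
    simp [hc]
  have hmeas : Measurable (Function.uncurry fun (s : ℝ) (ω : Ω) => g (X (Q i s) ω)) :=
    hgL.continuous.measurable.comp (hX.measurable_comp (hQ.mono i).measurable)
  refine ⟨integrable_sq_timeAverage hmeas (fun s ω => hg1 _) (by linarith),
    integral_sq_timeAverage_le hmeas (fun s ω => hg1 _) (fun s t hs hst => ?_) hT⟩
  -- With all other factors equal to 1, the product correlation reduces to that of g alone.
  have h := hC (fun j => if j = i then g else fun _ => 1)
    (fun j => by
      by_cases h : j = i
      · simpa [h] using hgL
      · simpa [h] using LipschitzWith.const' (K := (N : ℝ≥0)) (1 : ℝ))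
    (fun j x => by
      by_cases h : j = i
      · simpa [h] using hg1 x
      · simp [h]) i (by simpa using hg0) s t hs hst
  have hone : ∀ u ω, ∏ j with j < i, (if j = i then g else fun _ => 1) (X (Q j u) ω) = 1 :=
    fun u ω => Finset.prod_eq_one fun j hj => by simp [(Finset.mem_filter.1 hj).2.ne]
  simpa [hone] using h

theorem summable_pow_mul_inv_two_pow (N : ℕ) :
    Summable fun k : ℕ => ((k : ℝ) + 1) ^ N * (2 ^ k)⁻¹ := by
  have h := (summable_nat_add_iff 1).2
    (summable_pow_mul_geometric_of_norm_lt_one (R := ℝ) N (r := 2⁻¹) (by norm_num))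
  refine (h.mul_left 2).congr fun k => ?_
  push_cast
  rw [pow_succ (2⁻¹ : ℝ) k, inv_pow]; ring

/-- The time averages of a power of the norm are almost surely bounded. -/
theorem ae_bddAbove_timeAverage (hX : IsMixingProcess P 𝓕 X μ) (hQ : IsSeparating Q ε)
    (hε : 0 < ε) (i : Fin ℓ) {N : ℕ} (hN : Integrable (fun x => ‖x‖ ^ N) μ)
    (hN2 : Integrable (fun x => ‖x‖ ^ (N + 2)) μ) :
    ∀ᵐ ω ∂P, ∃ B : ℝ, ∀ T : ℝ, 1 ≤ T → 1 / T * ∫ s in (0 : ℝ)..T, ‖X (Q i s) ω‖ ^ N ≤ B := by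
  have := hX.isProbabilityMeasure
  have hr := (hQ.mono i).measurable
  -- Level k + 1 is paired with time 4^k: the second moment is then O(2^(-k)), which beats the
  -- squared scaling factor (k + 1)^(2N).
  obtain ⟨C, hC⟩ := hX.exists_integral_sq_truncPow_le hQ hε i N
  have hR : ∀ k : ℕ, (1 : ℝ) ≤ (k : ℝ) + 1 := fun k => by linarith [k.cast_nonneg (α := ℝ)]
  have hT : ∀ k : ℕ, (1 : ℝ) ≤ 4 ^ k := fun k => one_le_pow₀ (by norm_num)
  have hL := fun k : ℕ =>
    lipschitzWith_truncPow (E := EuclideanSpace ℝ (Fin d)) (N := N) (hR k)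
  have htm : ∀ k : ℕ, Measurable (truncPow N ((k : ℝ) + 1) : EuclideanSpace ℝ (Fin d) → ℝ) :=
    fun k => (hL k).continuous.measurable
  have habs : ∀ (k : ℕ) (x : EuclideanSpace ℝ (Fin d)), |truncPow N ((k : ℝ) + 1) x| ≤ 1 :=
    fun k x => by
      rw [abs_of_nonneg (truncPow_nonneg (hR k) x)]; exact truncPow_le_one (hR k) x
  set c : ℕ → ℝ := fun k => ∫ x, truncPow N ((k : ℝ) + 1) x ∂μ with hc
  set h : ℕ → EuclideanSpace ℝ (Fin d) → ℝ := fun k x =>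
    ‖x‖ ^ N - ((k : ℝ) + 1) ^ N * truncPow N ((k : ℝ) + 1) x with hh
  have hhm : ∀ k, Measurable (h k) := fun k =>
    (measurable_norm.pow_const N).sub ((htm k).const_mul _)
  have hti : ∀ k : ℕ, Integrable (truncPow N ((k : ℝ) + 1)) μ := fun k =>
    integrable_of_abs_le_one (htm k) (habs k)
  have hhi : ∀ k, Integrable (h k) μ := fun k => hN.sub ((hti k).const_mul _)
  have hh0 : ∀ k x, 0 ≤ h k x := fun k x => sub_nonneg.2 (pow_mul_truncPow_le (hR k) x)
  -- the truncation error
  have hD := ae_tendsto_zero_of_summable_integral (P := P)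
    (f := fun k ω => 1 / (4 : ℝ) ^ k * ∫ s in (0 : ℝ)..4 ^ k, h k (X (Q i s) ω))
    (c := fun k => (∫ x, ‖x‖ ^ (N + 2) ∂μ) * (((k : ℝ) + 1) ^ 2)⁻¹)
    (fun k => (hX.integrable_timeIntegral (hhm k) (hhi k) hr (by positivity)).const_mul _)
    (fun k ω => mul_nonneg (by positivity)
      (intervalIntegral.integral_nonneg (by positivity) fun s _ => hh0 k _))
    (fun k => by
      rw [integral_const_mul, hX.integral_timeIntegral (hhm k) (hhi k) hr (by positivity),
        ← mul_assoc, one_div, inv_mul_cancel₀ (by positivity), one_mul, ← integral_mul_const]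
      exact integral_mono (hhi k) (hN2.mul_const _) fun x => norm_pow_sub_le (hR k) x)
    (by
      refine Summable.mul_left _ ?_
      have := (summable_nat_add_iff 1).2 (Real.summable_nat_pow_inv.2 (one_lt_two))
      simpa using this)
  -- the fluctuations
  have hZ := ae_tendsto_zero_of_summable_integral (P := P)
    (f := fun k ω => (((k : ℝ) + 1) ^ N) ^ 2 * (1 / 4 ^ k * ∫ s in (0 : ℝ)..4 ^ k,
      (truncPow N ((k : ℝ) + 1) (X (Q i s) ω) - c k) / 2) ^ 2)
    (c := fun k => C * (((k : ℝ) + 1) ^ (N * 2) * (2 ^ k)⁻¹))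
    (fun k => (hC _ (hR k) _ (hT k)).1.const_mul _)
    (fun k ω => by positivity)
    (fun k => by
      rw [integral_const_mul]
      have h2 := (hC _ (hR k) _ (hT k)).2
      rw [show (4 : ℝ) ^ k = (2 ^ k) ^ 2 by rw [← pow_mul, mul_comm, pow_mul]; norm_num,
        Real.sqrt_sq (by positivity)] at h2
      rw [show (4 : ℝ) ^ k = (2 ^ k) ^ 2 by rw [← pow_mul, mul_comm, pow_mul]; norm_num]
      refine (mul_le_mul_of_nonneg_left h2 (by positivity)).trans_eq ?_
      rw [pow_mul]; ring)
    ((summable_pow_mul_inv_two_pow _).mul_left C)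
  filter_upwards [hD, hZ, hX.ae_intervalIntegrable (measurable_norm.pow_const N) hN hr]
    with ω hDω hZω hint
  have hZω' : Tendsto (fun k : ℕ => |((k : ℝ) + 1) ^ N * (1 / 4 ^ k * ∫ s in (0 : ℝ)..4 ^ k,
      (truncPow N ((k : ℝ) + 1) (X (Q i s) ω) - c k) / 2)|) atTop (𝓝 0) := by
    have := (Real.continuous_sqrt.tendsto 0).comp hZω
    simpa only [Function.comp_def, ← mul_pow, Real.sqrt_sq_eq_abs, Real.sqrt_zero] using this
  obtain ⟨B, hB⟩ := (hDω.add (hZω'.const_mul 2)).bddAbove_range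
  set w := ∫ x, ‖x‖ ^ N ∂μ with hw
  have hmeas : ∀ k : ℕ, Measurable fun s => truncPow N ((k : ℝ) + 1) (X (Q i s) ω) := fun k =>
    (htm k).comp ((hX.measurable_comp hr).comp measurable_prodMk_right)
  have hgeo : ∀ k : ℕ, 1 / 4 ^ k * ∫ s in (0 : ℝ)..4 ^ k, ‖X (Q i s) ω‖ ^ N ≤ B + w := by
    intro k
    have hBk := hB ⟨k, rfl⟩
    simp only at hBk
    have hTk : (0 : ℝ) < 4 ^ k := by positivity
    have it : IntervalIntegrable (fun s => truncPow N ((k : ℝ) + 1) (X (Q i s) ω)) volume 0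
        (4 ^ k) := intervalIntegrable_of_bounded (hmeas k)
          (fun s => (le_abs_self _).trans (by rw [abs_abs]; exact habs k _)) _ _
    have hck : ((k : ℝ) + 1) ^ N * c k ≤ w := by
      rw [hc, hw]
      simp only
      rw [← integral_const_mul]
      exact integral_mono ((hti k).const_mul _) hN fun x => pow_mul_truncPow_le (hR k) x
    have e1 : ∫ s in (0 : ℝ)..4 ^ k, h k (X (Q i s) ω) =
        (∫ s in (0 : ℝ)..4 ^ k, ‖X (Q i s) ω‖ ^ N) -
          ((k : ℝ) + 1) ^ N * ∫ s in (0 : ℝ)..4 ^ k, truncPow N ((k : ℝ) + 1) (X (Q i s) ω) := by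
      rw [← intervalIntegral.integral_const_mul,
        ← intervalIntegral.integral_sub (hint _ hTk.le) (it.const_mul _)]
    have e2 : ∫ s in (0 : ℝ)..4 ^ k, (truncPow N ((k : ℝ) + 1) (X (Q i s) ω) - c k) / 2 =
        ((∫ s in (0 : ℝ)..4 ^ k, truncPow N ((k : ℝ) + 1) (X (Q i s) ω)) - 4 ^ k * c k) / 2 := by
      rw [intervalIntegral.integral_div,
        intervalIntegral.integral_sub it intervalIntegrable_const]
      simp
    rw [e1, e2] at hBk
    set S := ∫ s in (0 : ℝ)..4 ^ k, truncPow N ((k : ℝ) + 1) (X (Q i s) ω)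
    set W := ∫ s in (0 : ℝ)..4 ^ k, ‖X (Q i s) ω‖ ^ N
    -- Truncation error, plus centred fluctuation, plus mean of the truncated power. The first two
    -- tend to 0 and the last is at most w.
    have e3 : 1 / 4 ^ k * W = 1 / 4 ^ k * (W - ((k : ℝ) + 1) ^ N * S) +
        2 * (((k : ℝ) + 1) ^ N * (1 / 4 ^ k * ((S - 4 ^ k * c k) / 2))) +
        ((k : ℝ) + 1) ^ N * c k := by
      field_simp; ring
    rw [e3]
    linarith [le_abs_self (((k : ℝ) + 1) ^ N * (1 / 4 ^ k * ((S - 4 ^ k * c k) / 2)))]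
  -- The integrand is nonnegative, so for 4^k ≤ T < 4^(k+1) the integral up to 4^(k+1) dominates, at
  -- the cost of the ratio 4.
  refine ⟨4 * (B + w), fun T hT1 => ?_⟩
  obtain ⟨k, hk1, hk2⟩ := exists_nat_pow_near hT1 (by norm_num : (1 : ℝ) < 4)
  have hk0 : (0 : ℝ) < 4 ^ k := by positivity
  have hle : ∫ s in (0 : ℝ)..T, ‖X (Q i s) ω‖ ^ N ≤
      ∫ s in (0 : ℝ)..4 ^ (k + 1), ‖X (Q i s) ω‖ ^ N :=
    intervalIntegral.integral_mono_interval le_rfl (by linarith) hk2.le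
      (Eventually.of_forall fun s => by positivity) (hint _ (by positivity))
  have hnn : 0 ≤ ∫ s in (0 : ℝ)..T, ‖X (Q i s) ω‖ ^ N :=
    intervalIntegral.integral_nonneg (by linarith) fun s _ => by positivity
  calc 1 / T * ∫ s in (0 : ℝ)..T, ‖X (Q i s) ω‖ ^ N
      ≤ 1 / 4 ^ k * ∫ s in (0 : ℝ)..4 ^ (k + 1), ‖X (Q i s) ω‖ ^ N := by gcongr
    _ = 4 * (1 / 4 ^ (k + 1) * ∫ s in (0 : ℝ)..4 ^ (k + 1), ‖X (Q i s) ω‖ ^ N) := by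
        rw [pow_succ]; field_simp
    _ ≤ 4 * (B + w) := by gcongr; exact hgeo (k + 1)

end IsMixingProcess

end

/-! ### The strong law of large numbers -/

theorem integrable_norm_pow_of_lintegral_lt_top {E : Type*} [NormedAddCommGroup E]
    [MeasurableSpace E] [BorelSpace E] [SecondCountableTopology E] {μ : Measure E}
    [IsFiniteMeasure μ] {r : ℝ} (hr : 0 < r) (h : ∫⁻ x, ‖x‖ₑ ^ r ∂μ < ∞) {n : ℕ} (hn : (n : ℝ) ≤ r) :
    Integrable (fun x => ‖x‖ ^ n) μ := by
  have h1 : MemLp (fun x : E => x) (ENNReal.ofReal r) μ := by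
    refine ⟨aestronglyMeasurable_id, ?_⟩
    rw [eLpNorm_lt_top_iff_lintegral_rpow_enorm_lt_top (by simpa using hr) ENNReal.ofReal_ne_top,
      ENNReal.toReal_ofReal hr.le]
    exact h
  have h2 : MemLp (fun x : E => x) (n : ℝ≥0∞) μ :=
    h1.mono_exponent (by rw [← ENNReal.ofReal_natCast]; exact ENNReal.ofReal_le_ofReal hn)
  rcases Nat.eq_zero_or_pos n with rfl | hn0
  · simp
  · exact h2.integrable_norm_pow hn0.ne'

theorem continuous_of_abs_sub_le {E : Type*} [NormedAddCommGroup E] {ℓ : ℕ}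
    {F : (Fin ℓ → E) → ℝ} {ι K κ : ℝ} (hι : 0 < ι) (hκ : 0 < κ)
    (hF : ∀ x y, |F x - F y| ≤
      K * (1 + ∑ j, ‖x j‖ ^ ι + ∑ j, ‖y j‖ ^ ι) * ∑ j, ‖x j - y j‖ ^ κ) : Continuous F := by
  refine continuous_iff_continuousAt.2 fun y => ?_
  refine tendsto_iff_norm_sub_tendsto_zero.2 ?_
  have hc : Continuous fun x : Fin ℓ → E =>
      K * (1 + ∑ j, ‖x j‖ ^ ι + ∑ j, ‖y j‖ ^ ι) * ∑ j, ‖x j - y j‖ ^ κ := by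
    have h1 : ∀ j, Continuous fun x : Fin ℓ → E => ‖x j‖ ^ ι := fun j =>
      (continuous_apply j).norm.rpow_const fun _ => Or.inr hι.le
    have h2 : ∀ j, Continuous fun x : Fin ℓ → E => ‖x j - y j‖ ^ κ := fun j =>
      ((continuous_apply j).sub continuous_const).norm.rpow_const fun _ => Or.inr hκ.le
    fun_prop
  have ht := hc.tendsto y
  simp only [sub_self, norm_zero, Real.zero_rpow hκ.ne', Finset.sum_const_zero, mul_zero] at ht
  exact squeeze_zero (fun _ => norm_nonneg _) (fun x => hF x y) ht

/-- Setting the time changes to 0 on s ≤ 0 makes them monotone, hence measurable, on all of ℝ. The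
slack 2 in `IsSeparating` pays for moving s to s + 1 ≥ 1 and rounding t - (s + 1) down to an
integer, since growth is assumed only in unit steps from time 1 on. -/
theorem isSeparating_of_growth {ℓ : ℕ} {q : Fin ℓ → ℝ → ℝ≥0}
    (hq_order : ∀ t, 0 < t → StrictMono fun i => q i t)
    (hq_mono : ∀ i, MonotoneOn (q i) (Set.Ioi 0)) {ε : ℝ} (hε : 0 < ε)
    (hq_gap : ∀ i j : Fin ℓ, (i : ℕ) + 1 = j → ∀ t : ℝ, 1 ≤ t → (q i t : ℝ) + ε * t ≤ q j t)
    (hq_growth : ∀ i, ∀ t : ℝ, 1 ≤ t → (q i t : ℝ) + ε ≤ q i (t + 1)) :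
    IsSeparating (fun i s => if 0 < s then q i s else 0) ε where
  mono i s t hst := by
    rcases lt_or_ge 0 s with hs | hs
    · simp only [hs, hs.trans_le hst, if_true]; exact hq_mono i hs (hs.trans_le hst) hst
    · simp [hs.not_gt]
  le_of_lt i j hji t ht := by
    simp only [ht, if_true]; exact (hq_order t ht).monotone hji.le
  growth i s t hs hst := by
    have ht : 0 < t := hs.trans_le hst
    simp only [hs, ht, if_true]
    have hm : ∀ a b : ℝ, 0 < a → a ≤ b → (q i a : ℝ) ≤ q i b := fun a b ha hab =>
      NNReal.coe_le_coe.2 (hq_mono i ha (ha.trans_le hab) hab)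
    rcases le_total (t - s - 2) 0 with h | h
    · nlinarith [hm s t hs hst]
    · have hit : ∀ (r : ℝ), 1 ≤ r → ∀ n : ℕ, (q i r : ℝ) + ε * n ≤ q i (r + n) := by
        intro r hr n
        induction n with
        | zero => simp
        | succ n ih =>
          have := hq_growth i (r + n) (by linarith [n.cast_nonneg (α := ℝ)])
          push_cast
          rw [← add_assoc]
          linarith
      have hr1 : s + 1 ≤ t := by linarith
      have hfl := Nat.floor_le (by linarith : 0 ≤ t - (s + 1))
      have hlt := Nat.lt_floor_add_one (t - (s + 1))
      calc (q i s : ℝ) + ε * (t - s - 2) ≤ q i (s + 1) + ε * ⌊t - (s + 1)⌋₊ := by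
            refine add_le_add (hm _ _ hs (by linarith)) ?_
            gcongr; linarith
        _ ≤ q i (s + 1 + ⌊t - (s + 1)⌋₊) := hit _ (by linarith) _
        _ ≤ q i t := hm _ _ (by positivity) (by linarith)
  gap i j hji t ht := by
    simp only [ht, if_true]
    have hmono : ∀ k l : Fin ℓ, k ≤ l → (q k t : ℝ) ≤ q l t := fun k l hkl =>
      NNReal.coe_le_coe.2 ((hq_order t ht).monotone hkl)
    -- For t < 1 the claimed gap is negative and the order suffices. For t ≥ 1 the gap between i - 1
    -- and i is enough, as j ≤ i - 1.
    rcases lt_or_ge t 1 with h | h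
    · nlinarith [hmono j i hji.le]
    · have hji' : (j : ℕ) < i := hji
      have hi1 : (i : ℕ) - 1 + 1 = i := by omega
      have h1 := hq_gap ⟨i - 1, by omega⟩ i hi1 t h
      have h2 := hmono j ⟨i - 1, by omega⟩ (by rw [Fin.le_def]; simp only; omega)
      nlinarith

section

variable {Ω : Type*} [mΩ : MeasurableSpace Ω] {P : Measure Ω} [IsProbabilityMeasure P]
  {𝓕 : EReal → EReal → MeasurableSpace Ω} {d ℓ : ℕ}
  {X : ℝ≥0 → Ω → EuclideanSpace ℝ (Fin d)} {μ : Measure (EuclideanSpace ℝ (Fin d))}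
  {Q : Fin ℓ → ℝ → ℝ≥0} {ε : ℝ}

theorem rpow_le_one_add_pow {r ι : ℝ} {N : ℕ} (hr : 0 ≤ r) (hι : 0 < ι) (hN : ι + 1 ≤ N) :
    r ^ ι ≤ 1 + r ^ N := by
  rcases le_total r 1 with h | h
  · exact (Real.rpow_le_one hr h hι.le).trans (by linarith [pow_nonneg hr N])
  · have := rpow_le_pow_div le_rfl h hN
    rw [div_one] at this; linarith

theorem abs_le_of_growth {F : (Fin ℓ → EuclideanSpace ℝ (Fin d)) → ℝ} {ι K : ℝ} (hι : 0 < ι)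
    (hK : 0 < K) (hFg : ∀ x, |F x| ≤ K * (1 + ∑ j, ‖x j‖ ^ ι)) {N : ℕ} (hN : ι + 1 ≤ N)
    (x : Fin ℓ → EuclideanSpace ℝ (Fin d)) :
    |F x| ≤ K * (1 + ∑ j, (1 + ‖x j‖ ^ N)) := by
  refine (hFg x).trans ?_
  gcongr with j
  exact rpow_le_one_add_pow (norm_nonneg _) hι hN

theorem integrable_norm_pow_pi [IsProbabilityMeasure μ] {N : ℕ}
    (hNi : Integrable (fun x => ‖x‖ ^ N) μ) (j : Fin ℓ) :
    Integrable (fun x : Fin ℓ → EuclideanSpace ℝ (Fin d) => ‖x j‖ ^ N)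
      (Measure.pi fun _ : Fin ℓ => μ) :=
  ((measurePreserving_eval (fun _ : Fin ℓ => μ) j).integrable_comp
    hNi.aestronglyMeasurable).2 hNi

theorem integrable_pi_of_growth [IsProbabilityMeasure μ]
    {F : (Fin ℓ → EuclideanSpace ℝ (Fin d)) → ℝ}
    (hF : Continuous F) {ι K : ℝ} (hι : 0 < ι) (hK : 0 < K)
    (hFg : ∀ x, |F x| ≤ K * (1 + ∑ j, ‖x j‖ ^ ι)) {N : ℕ} (hN : ι + 1 ≤ N)
    (hNi : Integrable (fun x => ‖x‖ ^ N) μ) :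
    Integrable F (Measure.pi fun _ : Fin ℓ => μ) := by
  have h : Integrable (fun x : Fin ℓ → EuclideanSpace ℝ (Fin d) =>
      K * (1 + ∑ j, (1 + ‖x j‖ ^ N))) (Measure.pi fun _ : Fin ℓ => μ) :=
    ((integrable_const _).add (integrable_finsetSum _ fun j _ =>
      (integrable_const _).add (integrable_norm_pow_pi hNi j))).const_mul K
  exact h.mono' hF.aestronglyMeasurable
    (Eventually.of_forall fun x => abs_le_of_growth hι hK hFg hN x)

namespace IsMixingProcess

/-- The approximants g n differ from F by at most V/(n + 1). Both the time averages of V and its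
integral are bounded, so the law passes from the g n to F outside one null set. -/
theorem ae_tendsto_timeAverage (hX : IsMixingProcess P 𝓕 X μ) (hQ : IsSeparating Q ε)
    (hε : 0 < ε) {F : (Fin ℓ → EuclideanSpace ℝ (Fin d)) → ℝ}
    (hF : Continuous F) {ι K : ℝ} (hι : 0 < ι) (hK : 0 < K)
    (hFg : ∀ x, |F x| ≤ K * (1 + ∑ j, ‖x j‖ ^ ι)) {N : ℕ} (hN : ι + 1 ≤ N)
    (hNi : Integrable (fun x => ‖x‖ ^ N) μ) (hNi2 : Integrable (fun x => ‖x‖ ^ (N + 2)) μ) :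
    ∀ᵐ ω ∂P, (∀ t : ℝ, 0 ≤ t →
        IntervalIntegrable (fun s => F fun i => X (Q i s) ω) volume 0 t) ∧
      Tendsto (fun t : ℝ => (1 / t) * ∫ s in (0 : ℝ)..t, F fun i => X (Q i s) ω) atTop
        (𝓝 (∫ x, F x ∂(Measure.pi fun _ : Fin ℓ => μ))) := by
  have := hX.isProbabilityMeasure
  set ν := Measure.pi fun _ : Fin ℓ => μ with hν
  choose g hg hgF using fun n : ℕ =>
    exists_mem_adjoin_near hF hι hK hFg hN (e := 1 / ((n : ℝ) + 1)) (by positivity)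
  have hFi := integrable_pi_of_growth hF hι hK hFg hN hNi
  set V : (Fin ℓ → EuclideanSpace ℝ (Fin d)) → ℝ := fun x => 1 + ∑ j, ‖x j‖ ^ N with hV
  have hVi : Integrable V ν := (integrable_const _).add
    (integrable_finsetSum _ fun j _ => integrable_norm_pow_pi hNi j)
  filter_upwards [ae_all_iff.2 fun n => hX.ae_tendsto_of_mem_adjoin hQ hε (hg n),
    ae_all_iff.2 fun j => hX.ae_intervalIntegrable (measurable_norm.pow_const N) hNi
      (hQ.mono j).measurable,
    ae_all_iff.2 fun j => hX.ae_bddAbove_timeAverage hQ hε j hNi hNi2] with ω hlim hint hbdd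
  have hFint : ∀ t : ℝ, 0 ≤ t →
      IntervalIntegrable (fun s => F fun i => X (Q i s) ω) volume 0 t := by
    intro t ht
    have h1 : IntervalIntegrable (∑ j, fun s => 1 + ‖X (Q j s) ω‖ ^ N) volume 0 t :=
      IntervalIntegrable.sum _ fun j _ => intervalIntegrable_const.add (hint j t ht)
    refine ((intervalIntegrable_const (c := (1 : ℝ)).add h1).const_mul K).mono_fun
      (hX.measurable_path hQ hF ω).aestronglyMeasurable (Eventually.of_forall fun s => ?_)
    refine (abs_le_of_growth hι hK hFg hN _).trans (le_trans (le_of_eq ?_) (le_abs_self _))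
    simp
  have hVint : ∀ t : ℝ, 0 ≤ t →
      IntervalIntegrable (fun s => V fun i => X (Q i s) ω) volume 0 t := by
    intro t ht
    have h1 : IntervalIntegrable (∑ j, fun s => ‖X (Q j s) ω‖ ^ N) volume 0 t :=
      IntervalIntegrable.sum _ fun j _ => hint j t ht
    have h2 := (intervalIntegrable_const (c := (1 : ℝ))).add h1
    simpa only [Finset.sum_apply] using h2
  refine ⟨hFint, ?_⟩
  choose B hB using hbdd
  have hVavg : ∀ t : ℝ, 1 ≤ t → 1 / t * ∫ s in (0 : ℝ)..t, V (fun i => X (Q i s) ω) ≤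
      1 + ∑ j, B j := by
    intro t ht
    have ht0 : 0 < t := by linarith
    simp only [hV]
    have h1 : IntervalIntegrable (fun s => ∑ j, ‖X (Q j s) ω‖ ^ N) volume 0 t := by
      have := IntervalIntegrable.sum Finset.univ fun j _ => hint j t ht0.le
      rwa [show (∑ j, fun s => ‖X (Q j s) ω‖ ^ N) = fun s => ∑ j, ‖X (Q j s) ω‖ ^ N by
        ext s; simp] at this
    rw [intervalIntegral.integral_add intervalIntegrable_const h1,
      intervalIntegral.integral_finsetSum fun j _ => hint j t ht0.le, mul_add, Finset.mul_sum]
    refine add_le_add (le_of_eq ?_) (Finset.sum_le_sum fun j _ => hB j t ht)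
    simp [ht0.ne']
  set b := 1 + ∑ j, B j with hb
  have hVν : 0 ≤ ∫ x, V x ∂ν := integral_nonneg fun x => by simp only [hV]; positivity
  have hb0 : 0 ≤ b := by
    refine le_trans ?_ (hVavg 1 le_rfl)
    refine mul_nonneg (by norm_num) (intervalIntegral.integral_nonneg zero_le_one fun s _ => ?_)
    simp only [hV]; positivity
  refine Metric.tendsto_atTop'.2 fun δ hδ => ?_
  -- Half of δ covers the errors of replacing F by g n in the average and in the integral, the other
  -- half the convergence for g n. The + 1 keeps the denominator positive.
  obtain ⟨n, hn⟩ := exists_nat_one_div_lt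
    (show 0 < δ / (2 * (b + ∫ x, V x ∂ν + 1)) by positivity)
  set e : ℝ := 1 / ((n : ℝ) + 1) with he
  have he0 : 0 < e := by positivity
  have hen : e * (b + ∫ x, V x ∂ν) < δ / 2 := by
    rw [lt_div_iff₀ (by positivity)] at hn
    linarith
  obtain ⟨T, hT⟩ := Metric.tendsto_atTop'.1 (hlim n) (δ / 2) (by positivity)
  refine ⟨max T 1, fun t ht => ?_⟩
  have htT := hT t ((le_max_left _ _).trans_lt ht)
  have ht1 : 1 ≤ t := ((le_max_right _ _).trans_lt ht).le
  have ht0 : 0 < t := by linarith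
  obtain ⟨C, hC⟩ := exists_bound_of_mem_adjoin (hg n)
  have hgint : IntervalIntegrable (fun s => g n fun i => X (Q i s) ω) volume 0 t :=
    intervalIntegrable_of_bounded (hX.measurable_path hQ (g n).continuous ω) (fun s =>
      (le_abs_self _).trans (by rw [abs_abs]; exact hC _)) 0 t
  have h1 : |1 / t * (∫ s in (0 : ℝ)..t, F fun i => X (Q i s) ω) -
      1 / t * ∫ s in (0 : ℝ)..t, g n fun i => X (Q i s) ω| ≤ e * b := by
    rw [← mul_sub, ← intervalIntegral.integral_sub (hFint t ht0.le) hgint, abs_mul,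
      abs_of_nonneg (by positivity : 0 ≤ 1 / t)]
    have h2 := intervalIntegral.norm_integral_le_of_norm_le ht0.le
      (f := fun s => F (fun i => X (Q i s) ω) - g n fun i => X (Q i s) ω)
      (Eventually.of_forall fun s _ => hgF n fun i => X (Q i s) ω)
      ((hVint t ht0.le).const_mul e)
    rw [intervalIntegral.integral_const_mul] at h2
    calc 1 / t * |∫ s in (0 : ℝ)..t, (F (fun i => X (Q i s) ω) - g n fun i => X (Q i s) ω)|
        ≤ 1 / t * (e * ∫ s in (0 : ℝ)..t, V fun i => X (Q i s) ω) := by gcongr; exact h2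
      _ = e * (1 / t * ∫ s in (0 : ℝ)..t, V fun i => X (Q i s) ω) := by ring
      _ ≤ e * b := by gcongr; exact hVavg t ht1
  have h3 : |(∫ x, g n x ∂ν) - ∫ x, F x ∂ν| ≤ e * ∫ x, V x ∂ν := by
    rw [abs_sub_comm, ← integral_sub hFi (integrable_of_mem_adjoin (hg n)),
      ← integral_const_mul]
    exact norm_integral_le_of_norm_le (f := fun x => F x - g n x) (hVi.const_mul e)
      (Eventually.of_forall fun x => hgF n x)
  rw [Real.dist_eq] at htT ⊢
  rw [abs_le] at h1 h3
  rw [abs_lt] at htT ⊢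
  constructor <;> linarith

end IsMixingProcess

end

theorem corollary2p4 {Ω : Type*} [MeasurableSpace Ω] (P : Measure Ω) [IsProbabilityMeasure P]
    (d ℓ : ℕ) (hℓ : 1 ≤ ℓ)
    -- the process and its time-independent one-dimensional distribution
    (X : ℝ≥0 → Ω → EuclideanSpace ℝ (Fin d))
    (hX : Measurable (Function.uncurry X))
    (μ : Measure (EuclideanSpace ℝ (Fin d)))
    (hμ : ∀ t, P.map (X t) = μ)
    -- the two-parameter family of σ-algebras
    (𝓕 : EReal → EReal → MeasurableSpace Ω)
    (h𝓕_le : ∀ s t, s ≤ t → 𝓕 s t ≤ ‹MeasurableSpace Ω›)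
    (h𝓕_mono : ∀ s t s' t', s ≤ t → s' ≤ s → t ≤ t' → 𝓕 s t ≤ 𝓕 s' t')
    -- the observable
    (F : (Fin ℓ → EuclideanSpace ℝ (Fin d)) → ℝ)
    (ι K κ : ℝ) (hι : 0 < ι) (hK : 0 < K) (hκ : 0 < κ) (hκ_one : κ ≤ 1)
    (hF_holder : ∀ x y, |F x - F y| ≤
      K * (1 + ∑ j, ‖x j‖ ^ ι + ∑ j, ‖y j‖ ^ ι) * ∑ j, ‖x j - y j‖ ^ κ)
    (hF_growth : ∀ x, |F x| ≤ K * (1 + ∑ j, ‖x j‖ ^ ι))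
    -- mixing, approximation and moments
    (hmix : MixingAssumption P 𝓕 X μ ℓ ι κ)
    -- the time changes
    (q : Fin ℓ → ℝ → ℝ≥0)
    (hq_pos : ∀ i t, 0 < t → 0 < q i t)
    (hq_order : ∀ t, 0 < t → StrictMono fun i => q i t)
    (hq_mono : ∀ i, MonotoneOn (q i) (Set.Ioi 0))
    (ε : ℝ) (hε : 0 < ε) (hε_one : ε ≤ 1)
    (hq_gap : ∀ i j : Fin ℓ, (i : ℕ) + 1 = j → ∀ t : ℝ, 1 ≤ t →
      (q i t : ℝ) + ε * t ≤ q j t)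
    (hq_growth : ∀ i, ∀ t : ℝ, 1 ≤ t → (q i t : ℝ) + ε ≤ q i (t + 1)) :
    Integrable F (Measure.pi fun _ : Fin ℓ => μ) ∧
    ∀ᵐ ω ∂P,
      (∀ t : ℝ, 0 ≤ t →
        IntervalIntegrable (fun s => F fun i => X (q i s) ω) volume 0 t) ∧
      Tendsto (fun t : ℝ => (1 / t) * ∫ s in (0 : ℝ)..t, F fun i => X (q i s) ω) atTop
        (𝓝 (∫ x, F x ∂(Measure.pi fun _ : Fin ℓ => μ))) := by
  have hX : IsMixingProcess P 𝓕 X μ := ⟨hX, hμ, h𝓕_le, h𝓕_mono, hmix.hasMixingRate hℓ hκ_one⟩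
  have hQ := isSeparating_of_growth hq_order hq_mono hε hq_gap hq_growth
  have hF := continuous_of_abs_sub_le hι hκ hF_holder
  have := hX.isProbabilityMeasure
  obtain ⟨p, r, θ, m, -, hr, -, -, -, -, -, hmom, -⟩ := hmix
  -- N = ⌈ι⌉ + 1, and the moment of order N + 2 is available because ⌈ι⌉ + 3 < ι + 4 ≤ 2r(ι + 2).
  have hN : ι + 1 ≤ ((⌈ι⌉₊ + 1 : ℕ) : ℝ) := by push_cast; linarith [Nat.le_ceil ι]
  have hNr : ((⌈ι⌉₊ + 1 + 2 : ℕ) : ℝ) ≤ 2 * r * (ι + 2) := by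
    have := Nat.ceil_lt_add_one hι.le
    push_cast
    nlinarith
  have hr0 : 0 < 2 * r * (ι + 2) := by positivity
  have hNi := integrable_norm_pow_of_lintegral_lt_top hr0 hmom (n := ⌈ι⌉₊ + 1)
    (le_trans (by push_cast; linarith) hNr)
  have hNi2 := integrable_norm_pow_of_lintegral_lt_top hr0 hmom hNr
  refine ⟨integrable_pi_of_growth hF hι hK hF_growth hN hNi, ?_⟩
  filter_upwards [hX.ae_tendsto_timeAverage hQ hε hF hι hK hF_growth hN hNi hNi2] with ω hω
  have heq : ∀ s : ℝ, 0 < s → (F fun i => X (if 0 < s then q i s else 0) ω) =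
      F fun i => X (q i s) ω := fun s hs => by simp only [hs, if_true]
  refine ⟨fun t ht => (hω.1 t ht).congr ?_, hω.2.congr' ?_⟩
  · intro s hs
    rw [Set.uIoc_of_le ht] at hs
    exact heq s hs.1
  · filter_upwards [eventually_ge_atTop 0] with t ht
    rw [intervalIntegral.integral_of_le ht, intervalIntegral.integral_of_le ht,
      setIntegral_congr_fun measurableSet_Ioc fun s hs => heq s hs.1]
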